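/- Let $k$ be an arbitrary field, let $\mathbf K=k(\xi_1,\xi_2,\dots)$ be the rational function field in countably many variables, and let the infinite symmetric group $\mathfrak S=\bigcup_{n\ge 1}\mathfrak S_n$ act on $\mathbf K$ by permuting the variables; let $\mathfrak S^n\subset\mathfrak S$ be the subgroup fixing each of $1,\dots,n$. Let $\mathcal A$ be the abelian category of smooth $\mathbf K$-semilinear representations of $\mathfrak S$: its objects are the $\mathbf K$-vector spaces $M$ with an additive action of $\mathfrak S$ such that $\sigma(av)=(\sigma a)(\sigma v)$ for all $\sigma\in\mathfrak S$, $a\in\mathbf K$, $v\in M$, and such that every $v\in M$ is fixed by $\mathfrak S^n$ for some $n$ (depending on $v$); its morphisms are the $\mathbf K$-linear $\mathfrak S$-equivariant maps. An object $M$ of $\mathcal A$ is finitely generated if it is spanned over $\mathbf K$ by the $\mathfrak S$-orbits of finitely many elements. For $r\ge 0$ let $\mathbf I^r\in\mathcal A$ be the $\mathbf K$-vector space with basis $(e_S)$ indexed by the $r$-element subsets $S$ of $\{1,2,\dots\}$, with $\sigma(a e_S)=(\sigma a)\,e_{\sigma(S)}$. An object of $\mathcal A$ is standard if it is isomorphic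 to a (possibly empty or infinite) direct sum of objects of the form $\mathbf I^r$, with $r$ allowed to vary. Let $M\in\mathcal A$ be finitely generated. Then $M$ has finite injective dimension in $\mathcal A$. Moreover, there are an integer $n\ge 0$ and a resolution (that is, an exact sequence in $\mathcal A$) $$0\to M\to I^0\to I^1\to\cdots\to I^n\to 0$$ in which each $I^i$ is a finitely generated standard object. -/

import Mathlib

open CategoryTheory CategoryTheory.Limits

universe u

noncomputable section

/-! ### The infinite symmetric group and the rational function field

The index set `{1, 2, 3, …}` is replaced by `ℕ = {0, 1, 2, …}` (the natural number `i` stands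
for the index `i + 1`). -/

/-- The infinite symmetric group `𝔖 = ⋃ₙ 𝔖ₙ`: the permutations of `ℕ` that fix all but finitely
many elements. -/
def InfSymm : Subgroup (Equiv.Perm ℕ) where
  carrier := {σ | ∃ n : ℕ, ∀ i, n ≤ i → σ i = i}
  one_mem' := ⟨0, fun _ _ => rfl⟩
  mul_mem' := by
    rintro σ τ ⟨m, hm⟩ ⟨n, hn⟩
    refine ⟨max m n, fun i hi => ?_⟩
    rw [Equiv.Perm.mul_apply, hn i (le_trans (le_max_right _ _) hi),
      hm i (le_trans (le_max_left _ _) hi)]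
  inv_mem' := by
    rintro σ ⟨m, hm⟩
    exact ⟨m, fun i hi => by rw [Equiv.Perm.inv_eq_iff_eq, hm i hi]⟩

/-- The subgroup `𝔖ⁿ` of `𝔖` of the permutations fixing each of the first `n` indices. -/
def InfSymm.fixing (n : ℕ) : Subgroup InfSymm where
  carrier := {σ | ∀ i, i < n → (σ : Equiv.Perm ℕ) i = i}
  one_mem' := fun _ _ => rfl
  mul_mem' := by
    intro σ τ hσ hτ i hi
    simp only [Set.mem_ofPred_eq] at hσ hτ
    rw [Subgroup.coe_mul, Equiv.Perm.mul_apply, hτ i hi, hσ i hi]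
  inv_mem' := by
    intro σ hσ i hi
    simp only [Set.mem_ofPred_eq] at hσ
    rw [Subgroup.coe_inv, Equiv.Perm.inv_eq_iff_eq, hσ i hi]

/-- The rational function field `𝐊 = k(ξ₁, ξ₂, …)` in countably many variables. -/
abbrev RatField (k : Type u) [Field k] : Type u := FractionRing (MvPolynomial ℕ k)

/-- The action of `𝔖` on `k[ξ₁, ξ₂, …]` by permuting the variables. -/
def InfSymm.polyAction (k : Type u) [Field k] :
    InfSymm →* (MvPolynomial ℕ k ≃+* MvPolynomial ℕ k) where
  toFun σ := (MvPolynomial.renameEquiv k (σ : Equiv.Perm ℕ)).toRingEquiv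
  map_one' := by
    refine RingEquiv.ext fun p => ?_
    change MvPolynomial.rename (id : ℕ → ℕ) p = p
    simp
  map_mul' σ τ := by
    refine RingEquiv.ext fun p => ?_
    change MvPolynomial.rename (⇑(σ : Equiv.Perm ℕ) ∘ ⇑(τ : Equiv.Perm ℕ)) p =
      MvPolynomial.rename _ (MvPolynomial.rename _ p)
    rw [MvPolynomial.rename_rename]

/-- The action of `𝔖` on `𝐊` by permuting the variables. -/
instance RatField.action (k : Type u) [Field k] : MulSemiringAction InfSymm (RatField k) :=
  MulSemiringAction.compHom (RatField k)
    ((IsFractionRing.ringEquivOfRingEquivHom (MvPolynomial ℕ k) (RatField k)).comp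
      (InfSymm.polyAction k))

theorem RatField.smul_algebraMap {k : Type u} [Field k] (σ : InfSymm) (p : MvPolynomial ℕ k) :
    σ • algebraMap (MvPolynomial ℕ k) (RatField k) p =
      algebraMap (MvPolynomial ℕ k) (RatField k)
        (MvPolynomial.rename (σ : Equiv.Perm ℕ) p) :=
  IsFractionRing.ringEquivOfRingEquiv_algebraMap _ _

/-! ### The category `𝓐` -/

/-- An object of `𝓐`: a smooth `𝐊`-semilinear representation of `𝔖`. -/
structure SmoothRep (k : Type u) [Field k] where
  carrier : Type u
  [addCommGroup : AddCommGroup carrier]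
  [module : Module (RatField k) carrier]
  [action : DistribMulAction InfSymm carrier]
  semilinear : ∀ (σ : InfSymm) (a : RatField k) (v : carrier), σ • (a • v) = (σ • a) • (σ • v)
  smooth : ∀ v : carrier, ∃ n : ℕ, ∀ σ ∈ InfSymm.fixing n, σ • v = v

namespace SmoothRep

variable {k : Type u} [Field k]

instance : CoeSort (SmoothRep k) (Type u) := ⟨SmoothRep.carrier⟩

attribute [instance] SmoothRep.addCommGroup SmoothRep.module SmoothRep.action

/-- Morphisms of `𝓐`: the `𝐊`-linear `𝔖`-equivariant maps. -/
@[ext]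
structure Hom (M N : SmoothRep k) where
  hom : M →ₗ[RatField k] N
  equivariant : ∀ (σ : InfSymm) (v : M), hom (σ • v) = σ • hom v

instance : Category (SmoothRep k) where
  Hom M N := Hom M N
  id M := ⟨LinearMap.id, fun _ _ => rfl⟩
  comp f g := ⟨g.hom ∘ₗ f.hom, fun σ v => by simp [f.equivariant, g.equivariant]⟩

@[ext]
theorem hom_ext {M N : SmoothRep k} {f g : M ⟶ N} (h : ∀ v, f.hom v = g.hom v) : f = g :=
  Hom.ext (LinearMap.ext h)

@[simp] theorem id_apply (M : SmoothRep k) (v : M) : Hom.hom (𝟙 M) v = v := rfl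

@[simp] theorem comp_apply {M N P : SmoothRep k} (f : M ⟶ N) (g : N ⟶ P) (v : M) :
    (f ≫ g).hom v = g.hom (f.hom v) := rfl

theorem map_smul {M N : SmoothRep k} (f : M ⟶ N) (σ : InfSymm) (v : M) :
    f.hom (σ • v) = σ • f.hom v := f.equivariant σ v

/-! ### `𝓐` is an abelian category (with kernels, cokernels and sums the evident ones) -/

section Preadditive

variable {M N : SmoothRep k}

instance : Zero (M ⟶ N) := ⟨⟨0, fun σ v => by simp⟩⟩
instance : Add (M ⟶ N) := ⟨fun f g => ⟨f.hom + g.hom, fun σ v => by simp [map_smul]⟩⟩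
instance : Neg (M ⟶ N) := ⟨fun f => ⟨-f.hom, fun σ v => by simp [map_smul]⟩⟩
instance : Sub (M ⟶ N) := ⟨fun f g => ⟨f.hom - g.hom, fun σ v => by simp [map_smul, smul_sub]⟩⟩
instance : SMul ℕ (M ⟶ N) :=
  ⟨fun n f => ⟨n • f.hom, fun σ v => by simp [map_smul, smul_comm n σ]⟩⟩
instance : SMul ℤ (M ⟶ N) :=
  ⟨fun n f => ⟨n • f.hom, fun σ v => by simp [map_smul, smul_comm n σ]⟩⟩

instance : AddCommGroup (M ⟶ N) :=
  Function.Injective.addCommGroup (fun f : M ⟶ N => f.hom) (fun _ _ h => Hom.ext h)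
    rfl (fun _ _ => rfl) (fun _ => rfl) (fun _ _ => rfl) (fun _ _ => rfl) (fun _ _ => rfl)

@[simp] theorem zero_apply (v : M) : Hom.hom (0 : M ⟶ N) v = 0 := rfl

@[simp] theorem add_apply (f g : M ⟶ N) (v : M) : (f + g).hom v = f.hom v + g.hom v := rfl

instance : Preadditive (SmoothRep k) where
  add_comp _ _ _ f f' g := by ext v; simp
  comp_add _ _ _ f g g' := by ext v; simp

end Preadditive

/-- The zero object. -/
def zeroRep (k : Type u) [Field k] : SmoothRep k where
  carrier := PUnit
  action :=
    { smul := fun _ _ => PUnit.unit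
      one_smul := fun _ => rfl
      mul_smul := fun _ _ _ => rfl
      smul_zero := fun _ => rfl
      smul_add := fun _ _ _ => rfl }
  semilinear _ _ _ := rfl
  smooth _ := ⟨0, fun _ _ => rfl⟩

theorem isZero_zeroRep : IsZero (zeroRep k) := by
  rw [IsZero.iff_id_eq_zero]
  ext v
  rfl

instance : HasZeroObject (SmoothRep k) := ⟨⟨_, isZero_zeroRep⟩⟩

/-- The direct sum of two objects. -/
def prod (M N : SmoothRep k) : SmoothRep k where
  carrier := M × N
  semilinear σ a v := Prod.ext (M.semilinear σ a v.1) (N.semilinear σ a v.2)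
  smooth v := by
    obtain ⟨m, hm⟩ := M.smooth v.1
    obtain ⟨n, hn⟩ := N.smooth v.2
    exact ⟨max m n, fun σ hσ => Prod.ext
      (hm σ fun i hi => hσ i (lt_of_lt_of_le hi (le_max_left _ _)))
      (hn σ fun i hi => hσ i (lt_of_lt_of_le hi (le_max_right _ _)))⟩

/-- The direct sum of two objects, as a bicone. -/
def prodBicone (M N : SmoothRep k) : BinaryBicone M N where
  pt := prod M N
  fst := ⟨LinearMap.fst _ _ _, fun _ _ => rfl⟩
  snd := ⟨LinearMap.snd _ _ _, fun _ _ => rfl⟩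
  inl := ⟨LinearMap.inl _ _ _, fun σ _ => Prod.ext rfl (smul_zero σ).symm⟩
  inr := ⟨LinearMap.inr _ _ _, fun σ _ => Prod.ext (smul_zero σ).symm rfl⟩
  inl_fst := by ext; rfl
  inl_snd := by ext; rfl
  inr_fst := by ext; rfl
  inr_snd := by ext; rfl

instance : HasBinaryBiproducts (SmoothRep k) :=
  ⟨fun M N => hasBinaryBiproduct_of_total (prodBicone M N) (by
    ext v
    exact Prod.ext (add_zero v.1) (zero_add v.2))⟩

instance : HasFiniteProducts (SmoothRep k) := hasFiniteProducts_of_has_binary_and_terminal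

/-- An `𝔖`-stable `𝐊`-subspace, as an object of `𝓐`. -/
def sub (M : SmoothRep k) (p : Submodule (RatField k) M)
    (hp : ∀ (σ : InfSymm) (v : M), v ∈ p → σ • v ∈ p) : SmoothRep k where
  carrier := p
  action :=
    { smul := fun σ v => ⟨σ • (v : M), hp σ v v.2⟩
      one_smul := fun v => Subtype.ext (one_smul _ (v : M))
      mul_smul := fun σ τ v => Subtype.ext (mul_smul σ τ (v : M))
      smul_zero := fun σ => Subtype.ext (smul_zero σ)
      smul_add := fun σ v w => Subtype.ext (smul_add σ (v : M) w) }
  semilinear σ a v := Subtype.ext (M.semilinear σ a v)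
  smooth v := by
    obtain ⟨n, hn⟩ := M.smooth v
    exact ⟨n, fun σ hσ => Subtype.ext (hn σ hσ)⟩

/-- The inclusion of a subobject. -/
def subι (M : SmoothRep k) (p : Submodule (RatField k) M)
    (hp : ∀ (σ : InfSymm) (v : M), v ∈ p → σ • v ∈ p) : sub M p hp ⟶ M :=
  ⟨p.subtype, fun _ _ => rfl⟩

/-- The quotient of an object by an `𝔖`-stable `𝐊`-subspace. -/
def quot (M : SmoothRep k) (p : Submodule (RatField k) M)
    (hp : ∀ (σ : InfSymm) (v : M), v ∈ p → σ • v ∈ p) : SmoothRep k where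
  carrier := M ⧸ p
  action :=
    { smul := fun σ => QuotientAddGroup.map p.toAddSubgroup p.toAddSubgroup
        (DistribSMul.toAddMonoidHom M σ) (hp σ)
      one_smul := by
        rintro ⟨v⟩
        exact congrArg (Submodule.Quotient.mk (p := p)) (one_smul InfSymm v)
      mul_smul := by
        rintro σ τ ⟨v⟩
        exact congrArg (Submodule.Quotient.mk (p := p)) (mul_smul σ τ v)
      smul_zero := fun σ => _root_.map_zero (QuotientAddGroup.map p.toAddSubgroup
        p.toAddSubgroup (DistribSMul.toAddMonoidHom M σ) (hp σ))
      smul_add := fun σ => _root_.map_add (QuotientAddGroup.map p.toAddSubgroup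
        p.toAddSubgroup (DistribSMul.toAddMonoidHom M σ) (hp σ)) }
  semilinear := by
    rintro σ a ⟨v⟩
    exact congrArg (Submodule.Quotient.mk (p := p)) (M.semilinear σ a v)
  smooth := by
    rintro ⟨v⟩
    obtain ⟨n, hn⟩ := M.smooth v
    exact ⟨n, fun σ hσ => congrArg (Submodule.Quotient.mk (p := p)) (hn σ hσ)⟩

/-- The projection to a quotient. -/
def quotπ (M : SmoothRep k) (p : Submodule (RatField k) M)
    (hp : ∀ (σ : InfSymm) (v : M), v ∈ p → σ • v ∈ p) : M ⟶ quot M p hp :=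
  ⟨p.mkQ, fun _ _ => rfl⟩

theorem ker_stable {M N : SmoothRep k} (f : M ⟶ N) (σ : InfSymm) (v : M)
    (hv : v ∈ LinearMap.ker f.hom) : σ • v ∈ LinearMap.ker f.hom := by
  rw [LinearMap.mem_ker] at hv ⊢
  rw [map_smul, hv, smul_zero]

theorem range_stable {M N : SmoothRep k} (f : M ⟶ N) (σ : InfSymm) (v : N)
    (hv : v ∈ LinearMap.range f.hom) : σ • v ∈ LinearMap.range f.hom := by
  obtain ⟨w, rfl⟩ := hv
  exact ⟨σ • w, map_smul f σ w⟩

theorem injective_of_mono {M N : SmoothRep k} (f : M ⟶ N) [Mono f] :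
    Function.Injective f.hom := by
  rw [← LinearMap.ker_eq_bot, LinearMap.ker_eq_bot']
  intro v hv
  have h : subι M (LinearMap.ker f.hom) (ker_stable f) = 0 := by
    rw [← cancel_mono f, zero_comp]
    ext w
    exact w.2
  exact congrArg (fun g => Hom.hom g (⟨v, hv⟩ : LinearMap.ker f.hom)) h

theorem surjective_of_epi {M N : SmoothRep k} (f : M ⟶ N) [Epi f] :
    Function.Surjective f.hom := by
  have h : quotπ N (LinearMap.range f.hom) (range_stable f) = 0 := by
    rw [← cancel_epi f, comp_zero]
    ext w
    exact (Submodule.Quotient.mk_eq_zero _).2 ⟨w, rfl⟩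
  intro v
  exact (Submodule.Quotient.mk_eq_zero (LinearMap.range f.hom)).1
    (congrArg (fun g => Hom.hom g v) h)

/-- Factor `h` through the injective morphism `f`. -/
def liftOfInjective {M N P : SmoothRep k} (f : M ⟶ N) (hf : Function.Injective f.hom)
    (h : P ⟶ N) (hr : ∀ v, h.hom v ∈ LinearMap.range f.hom) : { l : P ⟶ M // l ≫ f = h } :=
  let g : P →ₗ[RatField k] M :=
    (LinearEquiv.ofInjective f.hom hf).symm.toLinearMap ∘ₗ h.hom.codRestrict _ hr
  have hg : ∀ v, f.hom (g v) = h.hom v := fun v =>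
    congrArg Subtype.val
      ((LinearEquiv.ofInjective f.hom hf).apply_symm_apply (h.hom.codRestrict _ hr v))
  ⟨⟨g, fun σ v => hf (by rw [hg, map_smul, map_smul, hg])⟩, hom_ext hg⟩

/-- Factor `h` through the surjective morphism `f`. -/
def descOfSurjective {M N P : SmoothRep k} (f : M ⟶ N) (hf : Function.Surjective f.hom)
    (h : M ⟶ P) (hr : LinearMap.ker f.hom ≤ LinearMap.ker h.hom) :
    { l : N ⟶ P // f ≫ l = h } :=
  let g : N →ₗ[RatField k] P :=
    (LinearMap.ker f.hom).liftQ h.hom hr ∘ₗ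
      (f.hom.quotKerEquivOfSurjective hf).symm.toLinearMap
  have hg : ∀ v, g (f.hom v) = h.hom v := fun v => by
    have e : (f.hom.quotKerEquivOfSurjective hf).symm (f.hom v) = Submodule.Quotient.mk v := by
      rw [LinearEquiv.symm_apply_eq]
      rfl
    change (LinearMap.ker f.hom).liftQ h.hom hr
      ((f.hom.quotKerEquivOfSurjective hf).symm (f.hom v)) = h.hom v
    rw [e]
    rfl
  ⟨⟨g, fun σ v => by
    obtain ⟨w, rfl⟩ := hf v
    rw [← map_smul, hg, hg, map_smul]⟩, hom_ext hg⟩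

/-- An injective morphism is a kernel of every morphism whose kernel is its image. -/
def isLimitOfExact {M N P : SmoothRep k} (f : M ⟶ N) (g : N ⟶ P) (w : f ≫ g = 0)
    (hf : Function.Injective f.hom) (h : LinearMap.ker g.hom ≤ LinearMap.range f.hom) :
    IsLimit (KernelFork.ofι f w) :=
  have hfac : ∀ {W : SmoothRep k} (l : W ⟶ N), l ≫ g = 0 →
      ∀ v, l.hom v ∈ LinearMap.range f.hom :=
    fun l hl v => h (congrArg (fun q => Hom.hom q v) hl)
  KernelFork.IsLimit.ofι f w (fun l hl => (liftOfInjective f hf l (hfac l hl)).1)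
    (fun l hl => (liftOfInjective f hf l (hfac l hl)).2)
    (fun l hl m hm => by
      ext v
      apply hf
      exact congrArg (fun q => Hom.hom q v)
        (hm.trans (liftOfInjective f hf l (hfac l hl)).2.symm))

/-- A surjective morphism is a cokernel of every morphism whose image is its kernel. -/
def isColimitOfExact {M N P : SmoothRep k} (f : M ⟶ N) (g : N ⟶ P) (w : f ≫ g = 0)
    (hg : Function.Surjective g.hom) (h : LinearMap.ker g.hom ≤ LinearMap.range f.hom) :
    IsColimit (CokernelCofork.ofπ g w) :=
  have hfac : ∀ {W : SmoothRep k} (l : N ⟶ W), f ≫ l = 0 →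
      LinearMap.ker g.hom ≤ LinearMap.ker l.hom := by
    intro W l hl v hv
    obtain ⟨u, rfl⟩ := h hv
    exact congrArg (fun q => Hom.hom q u) hl
  CokernelCofork.IsColimit.ofπ g w (fun l hl => (descOfSurjective g hg l (hfac l hl)).1)
    (fun l hl => (descOfSurjective g hg l (hfac l hl)).2)
    (fun l hl m hm => by
      ext v
      obtain ⟨u, rfl⟩ := hg v
      exact congrArg (fun q => Hom.hom q u)
        (hm.trans (descOfSurjective g hg l (hfac l hl)).2.symm))

instance : HasKernels (SmoothRep k) :=
  ⟨fun f => HasLimit.mk ⟨_, isLimitOfExact (subι _ (LinearMap.ker f.hom) (ker_stable f)) f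
    (hom_ext fun v : LinearMap.ker f.hom => v.2) Subtype.val_injective
    (fun v hv => ⟨(⟨v, hv⟩ : LinearMap.ker f.hom), rfl⟩)⟩⟩

instance : HasCokernels (SmoothRep k) :=
  ⟨fun f => HasColimit.mk ⟨_, isColimitOfExact f (quotπ _ (LinearMap.range f.hom) (range_stable f))
    (by ext v; exact (Submodule.Quotient.mk_eq_zero _).2 ⟨v, rfl⟩)
    (Submodule.mkQ_surjective _) (fun _ hv => (Submodule.Quotient.mk_eq_zero _).1 hv)⟩⟩

instance : Abelian (SmoothRep k) where
  normalMonoOfMono f _ := ⟨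
    { Z := quot _ (LinearMap.range f.hom) (range_stable f)
      g := quotπ _ _ _
      w := by ext v; exact (Submodule.Quotient.mk_eq_zero _).2 ⟨v, rfl⟩
      isLimit := isLimitOfExact _ _ _ (injective_of_mono f)
        (fun _ hv => (Submodule.Quotient.mk_eq_zero _).1 hv) }⟩
  normalEpiOfEpi f _ := ⟨
    { W := sub _ (LinearMap.ker f.hom) (ker_stable f)
      g := subι _ _ _
      w := by ext v; exact v.2
      isColimit := isColimitOfExact _ _ _ (surjective_of_epi f)
        (fun v hv => ⟨(⟨v, hv⟩ : LinearMap.ker f.hom), rfl⟩) }⟩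

/-! ### Finitely generated objects and standard objects -/

/-- An object of `𝓐` is finitely generated if it is spanned over `𝐊` by the `𝔖`-orbits of
finitely many elements. -/
def IsFinitelyGenerated (M : SmoothRep k) : Prop :=
  ∃ s : Finset M, Submodule.span (RatField k) {v : M | ∃ σ : InfSymm, ∃ x ∈ s, v = σ • x} = ⊤

/-- The set of `r`-element sets of indices. -/
abbrev Subsets (r : ℕ) : Type := {S : Finset ℕ // S.card = r}

/-- The action of `𝔖` on `r`-element sets of indices. -/
def Subsets.perm {r : ℕ} (σ : InfSymm) (S : Subsets r) : Subsets r :=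
  ⟨S.1.map (σ : Equiv.Perm ℕ).toEmbedding, by rw [Finset.card_map, S.2]⟩

theorem Subsets.perm_one {r : ℕ} (S : Subsets r) : Subsets.perm 1 S = S :=
  Subtype.ext (Finset.map_refl)

theorem Subsets.perm_mul {r : ℕ} (σ τ : InfSymm) (S : Subsets r) :
    Subsets.perm (σ * τ) S = Subsets.perm σ (Subsets.perm τ S) :=
  Subtype.ext (Finset.map_map (τ : Equiv.Perm ℕ).toEmbedding (σ : Equiv.Perm ℕ).toEmbedding S.1).symm

/-- The `𝐊`-vector space with basis `e_S`, where `S` runs over the `r`-element sets of indices;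
that is, `𝐊 ⊗ₖ 𝐕ʳ`. (A type of its own, so that it does not carry the coefficientwise action
of `𝔖`.) -/
def StdSpace (k : Type u) [Field k] (r : ℕ) : Type u := Subsets r →₀ RatField k

namespace StdSpace

instance (r : ℕ) : AddCommGroup (StdSpace k r) :=
  inferInstanceAs (AddCommGroup (Subsets r →₀ RatField k))

instance (r : ℕ) : Module (RatField k) (StdSpace k r) :=
  inferInstanceAs (Module (RatField k) (Subsets r →₀ RatField k))

/-- The vector `a • e_S`. -/
def single {r : ℕ} (S : Subsets r) (a : RatField k) : StdSpace k r := Finsupp.single S a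

/-- The action of `σ ∈ 𝔖`, given by `σ (a • e_S) = σ(a) • e_{σ S}`. -/
def act {r : ℕ} (σ : InfSymm) : StdSpace k r →+ StdSpace k r :=
  Finsupp.liftAddHom (M := RatField k) (N := Subsets r →₀ RatField k)
    (fun S => (Finsupp.singleAddHom (Subsets.perm σ S)).comp
      (DistribSMul.toAddMonoidHom (RatField k) σ))

theorem act_single {r : ℕ} (σ : InfSymm) (S : Subsets r) (a : RatField k) :
    act σ (single S a) = single (Subsets.perm σ S) (σ • a) := by
  exact (Finsupp.liftAddHom_apply_single _ S a)

theorem induction {r : ℕ} {p : StdSpace k r → Prop} (v : StdSpace k r) (zero : p 0)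
    (add : ∀ v w, p v → p w → p (v + w)) (hs : ∀ S a, p (single S a)) : p v :=
  Finsupp.induction_linear v zero add hs

theorem smul_single {r : ℕ} (a b : RatField k) (S : Subsets r) :
    a • single S b = single S (a * b) :=
  Finsupp.smul_single a S b

instance (r : ℕ) : DistribMulAction InfSymm (StdSpace k r) where
  smul σ v := act σ v
  one_smul v := by
    change act 1 v = v
    induction v using StdSpace.induction with
    | zero => exact _root_.map_zero _
    | add v w hv hw => rw [_root_.map_add, hv, hw]
    | hs S a => rw [act_single, Subsets.perm_one, one_smul]
  mul_smul σ τ v := by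
    change act (σ * τ) v = act σ (act τ v)
    induction v using StdSpace.induction with
    | zero => simp only [_root_.map_zero]
    | add v w hv hw => simp only [_root_.map_add, hv, hw]
    | hs S a => rw [act_single, act_single, act_single, Subsets.perm_mul, mul_smul]
  smul_zero σ := _root_.map_zero (act σ)
  smul_add σ := _root_.map_add (act σ)

theorem perm_smul_single {r : ℕ} (σ : InfSymm) (S : Subsets r) (a : RatField k) :
    σ • single S a = single (Subsets.perm σ S) (σ • a) := act_single σ S a

end StdSpace

theorem poly_smooth (p : MvPolynomial ℕ k) :
    ∃ n : ℕ, ∀ σ ∈ InfSymm.fixing n,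
      MvPolynomial.rename ((σ : InfSymm) : Equiv.Perm ℕ) p = p := by
  refine ⟨p.vars.sup id + 1, fun σ hσ => ?_⟩
  conv_rhs => rw [← MvPolynomial.aeval_X_left_apply p]
  rw [MvPolynomial.rename_eq_aeval]
  refine MvPolynomial.eval₂Hom_congr' rfl (fun i hi _ => ?_) rfl
  exact congrArg _ (hσ i (Nat.lt_succ_of_le (Finset.le_sup (f := id) hi)))

theorem ratField_smooth (a : RatField k) :
    ∃ n : ℕ, ∀ σ ∈ InfSymm.fixing n, σ • a = a := by
  obtain ⟨p, q, hq, rfl⟩ := IsFractionRing.div_surjective (A := MvPolynomial ℕ k) a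
  obtain ⟨m, hm⟩ := poly_smooth p
  obtain ⟨n, hn⟩ := poly_smooth q
  refine ⟨max m n, fun σ hσ => ?_⟩
  rw [smul_div₀', RatField.smul_algebraMap, RatField.smul_algebraMap,
    hm σ fun i hi => hσ i (lt_of_lt_of_le hi (le_max_left _ _)),
    hn σ fun i hi => hσ i (lt_of_lt_of_le hi (le_max_right _ _))]

/-- The object `𝐈ʳ` of `𝓐`. -/
def std (k : Type u) [Field k] (r : ℕ) : SmoothRep k where
  carrier := StdSpace k r
  semilinear σ a v := by
    induction v using StdSpace.induction with
    | zero => simp only [smul_zero]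
    | add v w hv hw => simp only [smul_add, hv, hw]
    | hs S b =>
      rw [StdSpace.smul_single, StdSpace.perm_smul_single, StdSpace.perm_smul_single,
        StdSpace.smul_single, smul_mul']
  smooth v := by
    induction v using StdSpace.induction with
    | zero => exact ⟨0, fun σ _ => smul_zero σ⟩
    | add v w hv hw =>
      obtain ⟨m, hm⟩ := hv
      obtain ⟨n, hn⟩ := hw
      refine ⟨max m n, fun σ hσ => ?_⟩
      rw [smul_add, hm σ fun i hi => hσ i (lt_of_lt_of_le hi (le_max_left _ _)),
        hn σ fun i hi => hσ i (lt_of_lt_of_le hi (le_max_right _ _))]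
    | hs S a =>
      obtain ⟨m, hm⟩ := ratField_smooth a
      refine ⟨max m (S.1.sup id + 1), fun σ hσ => ?_⟩
      have h : Subsets.perm σ S = S := by
        apply Subtype.ext
        apply Finset.eq_of_subset_of_card_le
        · intro i hi
          obtain ⟨j, hj, rfl⟩ := Finset.mem_map.1 hi
          have : (σ : Equiv.Perm ℕ) j = j := hσ j (lt_of_lt_of_le
            (Nat.lt_succ_of_le (Finset.le_sup (f := id) hj)) (le_max_right _ _))
          change (σ : Equiv.Perm ℕ) j ∈ S.1
          rwa [this]
        · rw [S.2, (Subsets.perm σ S).2]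
      rw [StdSpace.perm_smul_single, h,
        hm σ fun i hi => hσ i (lt_of_lt_of_le hi (le_max_left _ _))]

open Classical in
/-- The direct sum of a family of objects of `𝓐`. -/
def directSum {ι : Type u} (X : ι → SmoothRep k) : SmoothRep k where
  carrier := Π₀ i, X i
  semilinear σ a v := DFinsupp.ext fun i => (X i).semilinear σ a (v i)
  smooth v := by
    induction v using DFinsupp.induction with
    | h0 => exact ⟨0, fun σ _ => smul_zero σ⟩
    | ha i x f _ _ hf =>
      obtain ⟨m, hm⟩ := hf
      obtain ⟨n, hn⟩ := (X i).smooth x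
      refine ⟨max m n, fun σ hσ => ?_⟩
      rw [smul_add, hm σ fun i hi => hσ i (lt_of_lt_of_le hi (le_max_left _ _)),
        ← DFinsupp.single_smul,
        hn σ fun i hi => hσ i (lt_of_lt_of_le hi (le_max_right _ _))]

/-- An object of `𝓐` is standard if it is isomorphic to a direct sum of objects `𝐈ʳ`. -/
def IsStandard (M : SmoothRep k) : Prop :=
  ∃ (ι : Type u) (r : ι → ℕ), Nonempty (M ≅ directSum fun i => std k (r i))

end SmoothRep

end

/-! Finitely generated objects are measured by degree: `Bounded V d N` says that `N` is generated
over 𝔖_V by finitely many vectors, each needing fewer than `d` indices besides those of `V`. The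
arguments are inductions on this degree, at the price of enlarging the finite set `V`. The theorem
comes from iterating `Bounded.exists_embedding`: an object of bounded degree embeds in a finite sum
of objects 𝐈ʳ, which are injective, with a cokernel of strictly smaller degree. The process stops
because an object with bound `0` is zero.

Injectivity of 𝐈ʳ. By `Bounded.exists_decomposition`, after restriction to a smaller group 𝔖_{V₀}, a
bounded subspace is covered by a part of a given stable subspace `A`, a part of lower degree, and a
part `C` spanned by orbits that are independent of the rest. Hence subspaces of bounded subspaces
are bounded (`Bounded.of_le`), and maps extend (`Bounded.exists_extension`), although the extension
is only equivariant for some 𝔖_{V'}. For the target 𝐈ʳ full equivariance is regained one index at a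
time (`exists_equivariant_of_insert`): the offending index is traded for a fresh one, which is then
erased by taking the constant term of a Laurent expansion. This works over every field `k`. Zorn's
lemma then splits each monomorphism out of 𝐈ʳ.

Smaller cokernel. For a set `S` of top degree `d`, dividing by the vectors that have a support not
containing `S` leaves a finite-dimensional semilinear representation of the stabilizer of `S`. It
has a basis of invariants (`span_stabilizer_invariants`): Laurent expansion removes the indices
outside `S` from the supports, and Galois descent handles the permutations of `S`. The dual basis
yields, by Frobenius reciprocity, finitely many morphisms to 𝐈ᵈ. Their common kernel has smaller
degree, so it embeds in a standard object by induction, and injectivity extends this embedding to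
the whole object. Since the functionals form a dual basis, the image fills the degree `d` part of
the target, so the cokernel has smaller degree. -/

section

open scoped Pointwise

/-! ### Finitary permutations, pointwise stabilizers and finite supports -/

namespace InfSymm

/-- The pointwise stabilizer of a finite set of indices. -/
def fixator (V : Finset ℕ) : Subgroup InfSymm := fixingSubgroup InfSymm (V : Set ℕ)

theorem mem_fixator {V : Finset ℕ} {σ : InfSymm} : σ ∈ fixator V ↔ ∀ i ∈ V, σ • i = i := by
  rw [fixator, mem_fixingSubgroup_iff]; rfl

theorem fixator_anti {V W : Finset ℕ} (h : V ⊆ W) : fixator W ≤ fixator V := fun _ hσ =>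
  mem_fixator.2 fun i hi => mem_fixator.1 hσ i (h hi)

theorem mem_fixator_union {V W : Finset ℕ} {σ : InfSymm} :
    σ ∈ fixator (V ∪ W) ↔ σ ∈ fixator V ∧ σ ∈ fixator W := by
  simp only [mem_fixator, Finset.mem_union]
  exact ⟨fun h => ⟨fun i hi => h i (Or.inl hi), fun i hi => h i (Or.inr hi)⟩,
    fun h i hi => hi.elim (h.1 i) (h.2 i)⟩

/-- A transposition. -/
def swap (i j : ℕ) : InfSymm :=
  ⟨Equiv.swap i j, max i j + 1, fun _ hl => Equiv.swap_apply_of_ne_of_ne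
    (by have := le_max_left i j; omega) (by have := le_max_right i j; omega)⟩

theorem swap_smul_left (i j : ℕ) : swap i j • i = j := Equiv.swap_apply_left i j

theorem swap_smul_right (i j : ℕ) : swap i j • j = i := Equiv.swap_apply_right i j

theorem swap_smul_of_ne {i j l : ℕ} (h : l ≠ i) (h' : l ≠ j) : swap i j • l = l :=
  Equiv.swap_apply_of_ne_of_ne h h'

theorem swap_mul_self (i j : ℕ) : swap i j * swap i j = 1 := Subtype.ext (Equiv.swap_mul_self i j)

theorem swap_mem_fixator {V : Finset ℕ} {i j : ℕ} (hi : i ∉ V) (hj : j ∉ V) :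
    swap i j ∈ fixator V :=
  mem_fixator.2 fun _ hl => swap_smul_of_ne (fun h => hi (h ▸ hl)) (fun h => hj (h ▸ hl))

/-- An injection of a finite set of indices into the indices extends to an element of `𝔖`. -/
theorem exists_smul_eq (f : ℕ → ℕ) (A : Finset ℕ) (hf : Set.InjOn f A) :
    ∃ σ : InfSymm, ∀ a ∈ A, σ • a = f a := by
  classical
  induction A using Finset.induction with
  | empty => exact ⟨1, by simp⟩
  | insert a A ha ih =>
    obtain ⟨σ, hσ⟩ := ih (hf.mono (by simp))
    -- The correcting transposition leaves the values on `A` alone: `σ • x = f x` differs from `σ •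
    -- a` and, by injectivity of `f`, from `f a`.
    refine ⟨swap (σ • a) (f a) * σ, fun x hx => ?_⟩
    rw [mul_smul]
    rcases Finset.mem_insert.1 hx with rfl | hx
    · exact swap_smul_left _ _
    · have hne : x ≠ a := fun h => ha (h ▸ hx)
      rw [swap_smul_of_ne, hσ x hx]
      · exact fun h => hne (MulAction.injective σ h)
      · rw [hσ x hx]
        exact fun h => hne (hf (by simp [hx]) (by simp) h)

/-- `𝔖_V` is transitive on the sets of a given cardinality that are disjoint from `V`. -/
theorem exists_smul_finset_eq {V S T : Finset ℕ} (hS : Disjoint S V) (hT : Disjoint T V)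
    (h : S.card = T.card) : ∃ σ ∈ fixator V, σ • S = T := by
  classical
  obtain e := Finset.equivOfCardEq h
  -- A bijection from `S` to `T` glued to the identity of `V`; it is injective because `S` and `T`
  -- both avoid `V`.
  let f : ℕ → ℕ := fun i => if hi : i ∈ S then e ⟨i, hi⟩ else i
  have hfS : ∀ i (hi : i ∈ S), f i = e ⟨i, hi⟩ := fun i hi => dif_pos hi
  have hfV : ∀ i ∈ V, f i = i := fun i hi =>
    dif_neg fun h => Finset.disjoint_left.1 hS h hi
  have hmem : ∀ i ∈ S, f i ∈ T := fun i hi => by rw [hfS i hi]; exact (e _).2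
  obtain ⟨σ, hσ⟩ := exists_smul_eq f (S ∪ V) (by
    intro i hi j hj hij
    simp only [Finset.coe_union, Set.mem_union, Finset.mem_coe] at hi hj
    rcases hi with hi | hi <;> rcases hj with hj | hj
    · rw [hfS i hi, hfS j hj] at hij
      simpa using e.injective (Subtype.ext hij)
    · exact (Finset.disjoint_left.1 hT (hmem i hi) (by rwa [hij, hfV j hj])).elim
    · exact (Finset.disjoint_left.1 hT (hmem j hj) (by rwa [← hij, hfV i hi])).elim
    · rwa [hfV i hi, hfV j hj] at hij)
  refine ⟨σ, mem_fixator.2 fun i hi => by rw [hσ i (by simp [hi]), hfV i hi],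
    Finset.eq_of_subset_of_card_le ?_ (by rw [Finset.card_smul_finset, h])⟩
  intro j hj
  obtain ⟨i, hi, rfl⟩ := Finset.mem_smul_finset.1 hj
  rw [hσ i (by simp [hi])]
  exact hmem i hi

theorem exists_disjoint_card (V : Finset ℕ) (d : ℕ) :
    ∃ S : Finset ℕ, S.card = d ∧ Disjoint S V := by
  obtain ⟨S, hS, h⟩ := (V.finite_toSet.infinite_compl).exists_subset_card_eq d
  exact ⟨S, h, Finset.disjoint_left.2 fun i hi => hS hi⟩

theorem exists_superset_disjoint_card {V U : Finset ℕ} {d : ℕ} (hU : U.card ≤ d)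
    (hV : Disjoint U V) : ∃ S : Finset ℕ, U ⊆ S ∧ S.card = d ∧ Disjoint S V := by
  classical
  obtain ⟨S, hS, h⟩ := exists_disjoint_card (U ∪ V) (d - U.card)
  rw [Finset.disjoint_union_right] at h
  refine ⟨U ∪ S, Finset.subset_union_left, ?_, Finset.disjoint_union_left.2 ⟨hV, h.2⟩⟩
  rw [Finset.card_union_of_disjoint h.1.symm]
  omega

/-- Finitely many elements of `P` represent the double cosets `𝔖_V \ 𝔖 / 𝔖_W` that meet `P`. -/
theorem exists_finite_reps (P : Set InfSymm) (V W : Finset ℕ) :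
    ∃ F ⊆ P, F.Finite ∧ ∀ σ ∈ P, ∃ τ ∈ F, ∃ ρ ∈ fixator V, ∀ w ∈ W, σ • w = ρ • τ • w := by
  classical
  -- The double coset of `σ` is determined by which elements of `W` are sent to which elements of
  -- `V`, and there are finitely many such patterns.
  let c : InfSymm → Finset (ℕ × ℕ) := fun σ => (W ×ˢ V).filter fun p => σ • p.1 = p.2
  obtain ⟨F, hF, hb⟩ := Set.exists_subset_bijOn P c
  have hfin : (c '' P).Finite := by
    refine ((W ×ˢ V).powerset.finite_toSet).subset ?_
    rintro _ ⟨σ, _, rfl⟩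
    exact Finset.mem_coe.2 (Finset.mem_powerset.2 (Finset.filter_subset _ _))
  refine ⟨F, hF, Set.Finite.of_finite_image (hb.image_eq ▸ hfin) hb.injOn, fun σ hσ => ?_⟩
  obtain ⟨τ, hτ, hc⟩ := hb.surjOn ⟨σ, hσ, rfl⟩
  have key : ∀ w ∈ W, ∀ v ∈ V, τ • w = v ↔ σ • w = v := fun w hw v hv => by
    have := congrArg (fun s => (w, v) ∈ s) hc
    simpa [c, hw, hv] using this
  -- The sought `ρ` must fix `V` and send `τ • w` to `σ • w`; the two demands are compatible because
  -- `σ` and `τ` have the same pattern.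
  let f : ℕ → ℕ := fun i => if i ∈ V then i else σ • τ⁻¹ • i
  have hfV : ∀ i ∈ V, f i = i := fun i hi => if_pos hi
  have hfW : ∀ w ∈ W, f (τ • w) = σ • w := fun w hw => by
    by_cases h : τ • w ∈ V
    · rw [hfV _ h]
      exact ((key w hw _ h).1 rfl).symm
    · simp [f, h]
  obtain ⟨ρ, hρ⟩ := exists_smul_eq f (V ∪ τ • W) (by
    intro i hi j hj hij
    simp only [Finset.coe_union, Set.mem_union, Finset.mem_coe] at hi hj
    rw [Finset.mem_smul_finset] at hi hj
    rcases hi with hi | ⟨i, hi, rfl⟩ <;> rcases hj with hj | ⟨j, hj, rfl⟩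
    · rwa [hfV i hi, hfV j hj] at hij
    · rw [hfV i hi, hfW j hj] at hij
      exact ((key j hj i hi).2 hij.symm).symm
    · rw [hfV j hj, hfW i hi] at hij
      exact (key i hi j hj).2 hij
    · rw [hfW i hi, hfW j hj] at hij
      rw [MulAction.injective σ hij])
  refine ⟨τ, hτ, ρ, mem_fixator.2 fun i hi => ?_, fun w hw => ?_⟩
  · rw [hρ i (by simp [hi]), hfV i hi]
  · rw [hρ _ (Finset.mem_union_right _ (Finset.smul_mem_smul_finset hw)), hfW w hw]

/-- If `i ∉ U` then `𝔖_{V ∖ i}` is generated by `𝔖_V` and `𝔖_U`. -/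
theorem exists_factorization {U V : Finset ℕ} {i : ℕ} (hU : i ∉ U) {σ : InfSymm}
    (hσ : σ ∈ fixator (V.erase i)) :
    ∃ α ∈ fixator V, ∃ β ∈ fixator U, ∃ ρ ∈ fixator V, σ = α * β * ρ := by
  classical
  by_cases hi : i ∈ V
  swap
  · rw [Finset.erase_eq_of_notMem hi] at hσ
    exact ⟨σ, hσ, 1, one_mem _, 1, one_mem _, by simp⟩
  rw [mem_fixator] at hσ
  by_cases hj : σ • i = i
  · refine ⟨σ, mem_fixator.2 fun l hl => ?_, 1, one_mem _, 1, one_mem _, by simp⟩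
    by_cases h : l = i
    · rw [h, hj]
    · exact hσ l (by simp [h, hl])
  have hjV : σ • i ∉ V := fun h => by
    have h1 := hσ _ (Finset.mem_erase.2 ⟨hj, h⟩)
    exact hj (MulAction.injective σ h1)
  -- The fresh index `m` is a stopover: `σ • i` is moved to `m` inside 𝔖_V, then `m` to `i` inside
  -- 𝔖_U, after which all of `V` is fixed.
  obtain ⟨m, hm⟩ := Infinite.exists_notMem_finset (insert i (insert (σ • i) (V ∪ U)))
  simp only [Finset.mem_insert, Finset.mem_union, not_or] at hm
  refine ⟨swap (σ • i) m, swap_mem_fixator hjV hm.2.2.1, swap m i,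
    swap_mem_fixator hm.2.2.2 hU, swap m i * (swap (σ • i) m * σ), ?_, ?_⟩
  · refine mem_fixator.2 fun l hl => ?_
    rw [mul_smul, mul_smul]
    by_cases h : l = i
    · rw [h, swap_smul_left, swap_smul_left]
    · have hm' : l ≠ m := fun h => hm.2.2.1 (h ▸ hl)
      have h1 : swap (σ • i) m • l = l := swap_smul_of_ne (fun h => hjV (h ▸ hl)) hm'
      rw [hσ l (by simp [h, hl]), h1, swap_smul_of_ne hm' h]
  · rw [mul_assoc, ← mul_assoc (swap m i), swap_mul_self, one_mul, ← mul_assoc, swap_mul_self,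
      one_mul]

section Supp

variable {X : Type*} [MulAction InfSymm X]

/-- `x` is fixed by the pointwise stabilizer of `V`. -/
def Supp (V : Finset ℕ) (x : X) : Prop := ∀ σ ∈ fixator V, σ • x = x

theorem Supp.mono {V W : Finset ℕ} {x : X} (h : Supp V x) (hVW : V ⊆ W) : Supp W x :=
  fun σ hσ => h σ (fixator_anti hVW hσ)

theorem Supp.smul_eq {V : Finset ℕ} {x : X} (h : Supp V x) {σ τ : InfSymm}
    (hστ : ∀ i ∈ V, σ • i = τ • i) : σ • x = τ • x := by
  rw [← inv_smul_eq_iff, ← mul_smul]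
  refine h _ (mem_fixator.2 fun i hi => ?_)
  rw [mul_smul, hστ i hi, inv_smul_smul]

theorem Supp.smul {V : Finset ℕ} {x : X} (h : Supp V x) (σ : InfSymm) :
    Supp (σ • V) (σ • x) := fun τ hτ => by
  rw [← mul_smul]
  refine h.smul_eq fun i hi => ?_
  rw [mul_smul]
  exact mem_fixator.1 hτ _ (Finset.smul_mem_smul_finset hi)

/-- This is how supports shrink: by `exists_factorization`, the group 𝔖_{V ∖ i} lies in the subgroup
generated by 𝔖_V and 𝔖_U, both of which fix `x`. -/
theorem Supp.erase {U V : Finset ℕ} {x : X} {i : ℕ} (h : Supp V x) (hU : Supp U x)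
    (hi : i ∉ U) : Supp (V.erase i) x := fun σ hσ => by
  obtain ⟨α, hα, β, hβ, ρ, hρ, rfl⟩ := exists_factorization hi hσ
  rw [mul_smul, mul_smul, h ρ hρ, hU β hβ, h α hα]

end Supp

theorem smul_finset_eq_self {V : Finset ℕ} {σ : InfSymm} (h : σ ∈ fixator V) : σ • V = V := by
  ext i
  rw [Finset.mem_smul_finset]
  exact ⟨by rintro ⟨j, hj, rfl⟩; rwa [mem_fixator.1 h j hj], fun hi => ⟨i, hi, mem_fixator.1 h i hi⟩⟩

theorem mem_fixator_range {n : ℕ} {σ : InfSymm} : σ ∈ fixator (Finset.range n) ↔ σ ∈ fixing n := by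
  rw [mem_fixator]
  exact ⟨fun h i hi => h i (Finset.mem_range.2 hi), fun h i hi => h i (Finset.mem_range.1 hi)⟩

end InfSymm

/-! ### Laurent expansion in one variable -/

namespace RatField

open InfSymm

variable {k : Type u} [Field k]

/-- The variable `ξ_i`. -/
noncomputable def var (k : Type u) [Field k] (i : ℕ) : RatField k :=
  algebraMap (MvPolynomial ℕ k) (RatField k) (MvPolynomial.X i)

/-- The constants. -/
noncomputable def const (k : Type u) [Field k] : k →+* RatField k :=
  (algebraMap (MvPolynomial ℕ k) (RatField k)).comp MvPolynomial.C

theorem smul_var (σ : InfSymm) (i : ℕ) : σ • var k i = var k (σ • i) := by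
  rw [var, smul_algebraMap, MvPolynomial.rename_X]; rfl

theorem smul_const (σ : InfSymm) (c : k) : σ • const k c = const k c := by
  simp only [const, RingHom.comp_apply, smul_algebraMap, MvPolynomial.rename_C]

theorem var_injective : Function.Injective (var k) := fun _ _ h =>
  MvPolynomial.X_injective (IsFractionRing.injective (MvPolynomial ℕ k) (RatField k) h)

theorem supp_var (i : ℕ) : Supp {i} (var k i) := fun σ hσ => by
  rw [smul_var, mem_fixator.1 hσ i (by simp)]

/-- Field homomorphisms out of `𝐊` that agree on the constants and on the finitely many variables
occurring in `a` agree at `a`. -/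
theorem exists_vars (a : RatField k) : ∃ V : Finset ℕ, ∀ {F : Type u} [Field F]
    (f g : RatField k →+* F), (∀ c, f (const k c) = g (const k c)) →
      (∀ i ∈ V, f (var k i) = g (var k i)) → f a = g a := by
  classical
  obtain ⟨p, q, hq, rfl⟩ := IsFractionRing.div_surjective (A := MvPolynomial ℕ k) a
  refine ⟨p.vars ∪ q.vars, fun {F} _ f g hc hv => ?_⟩
  have key : ∀ r : MvPolynomial ℕ k, r.vars ⊆ p.vars ∪ q.vars →
      f (algebraMap _ _ r) = g (algebraMap _ _ r) := fun r hr => by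
    have h : ∀ f : RatField k →+* F, f (algebraMap _ _ r) =
        MvPolynomial.eval₂Hom (f.comp (const k)) (fun i => f (var k i)) r := fun f => by
      rw [← RingHom.comp_apply]
      congr 1
      refine MvPolynomial.ringHom_ext (fun c => ?_) (fun i => ?_)
      · rw [MvPolynomial.coe_eval₂Hom, MvPolynomial.eval₂_C]; rfl
      · rw [MvPolynomial.coe_eval₂Hom, MvPolynomial.eval₂_X]; rfl
    rw [h f, h g]
    exact MvPolynomial.eval₂Hom_congr' (RingHom.ext hc) (fun i hi _ => hv i (hr hi)) rfl
  rw [map_div₀, map_div₀, key p Finset.subset_union_left, key q Finset.subset_union_right]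

/-- The action of `σ` as a ring endomorphism of `𝐊`. -/
noncomputable def smulHom (k : Type u) [Field k] (σ : InfSymm) : RatField k →+* RatField k :=
  MulSemiringAction.toRingHom InfSymm (RatField k) σ

theorem smulHom_apply (σ : InfSymm) (a : RatField k) : smulHom k σ a = σ • a := rfl

/-- Coefficientwise action on Laurent series. -/
noncomputable def laurentMap (k : Type u) [Field k] (σ : InfSymm) :
    LaurentSeries (RatField k) →+* LaurentSeries (RatField k) where
  toFun x := x.map (smulHom k σ)
  map_one' := by
    ext n
    simp only [HahnSeries.map_coeff, HahnSeries.coeff_one]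
    split_ifs <;> simp
  map_zero' := by ext n; simp
  map_add' x y := by ext n; simp
  map_mul' x y := HahnSeries.map_mul (smulHom k σ : RatField k →ₙ+* RatField k)

theorem laurentMap_coeff (σ : InfSymm) (x : LaurentSeries (RatField k)) (n : ℤ) :
    (laurentMap k σ x).coeff n = σ • x.coeff n := rfl

theorem laurentMap_C (σ : InfSymm) (a : RatField k) :
    laurentMap k σ (HahnSeries.C a) = HahnSeries.C (σ • a) := by
  ext n
  rw [laurentMap_coeff, HahnSeries.C_apply, HahnSeries.C_apply, HahnSeries.coeff_single,
    HahnSeries.coeff_single]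
  split_ifs <;> simp

theorem laurentMap_single (σ : InfSymm) (n : ℤ) :
    laurentMap k σ (HahnSeries.single n 1) = HahnSeries.single n 1 := by
  ext m
  rw [laurentMap_coeff, HahnSeries.coeff_single]
  split_ifs <;> simp

/-- The substitution of a polynomial variable for `ξ_i`. -/
noncomputable def toPolynomial (k : Type u) [Field k] (i : ℕ) :
    MvPolynomial ℕ k →+* Polynomial (RatField k) :=
  MvPolynomial.eval₂Hom (Polynomial.C.comp (const k))
    (fun j => if j = i then Polynomial.X else Polynomial.C (var k j))

/-- Evaluating the new variable at `ξ_i` recovers the embedding of the polynomial ring in 𝐊. -/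
theorem toPolynomial_injective (i : ℕ) : Function.Injective (toPolynomial k i) := by
  have h : (Polynomial.evalRingHom (var k i)).comp (toPolynomial k i) =
      algebraMap (MvPolynomial ℕ k) (RatField k) := by
    refine MvPolynomial.ringHom_ext (fun c => ?_) (fun j => ?_)
    · simp [toPolynomial, const]
    · by_cases hj : j = i
      · subst hj; simp [toPolynomial, var]
      · simp [toPolynomial, hj, var]
  refine Function.Injective.of_comp (f := Polynomial.evalRingHom (var k i)) ?_
  rw [← RingHom.coe_comp, h]
  exact IsFractionRing.injective _ _

theorem toLaurent_aux (i : ℕ) : Function.Injective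
    (((HahnSeries.ofPowerSeries ℤ (RatField k)).comp Polynomial.coeToPowerSeries.ringHom).comp
      (toPolynomial k i)) := by
  rw [RingHom.coe_comp, RingHom.coe_comp]
  exact (HahnSeries.ofPowerSeries_injective.comp (Polynomial.coe_injective _)).comp
    (toPolynomial_injective i)

/-- Laurent expansion in the variable `ξ_i`. -/
noncomputable def toLaurent (k : Type u) [Field k] (i : ℕ) :
    RatField k →+* LaurentSeries (RatField k) :=
  IsFractionRing.lift (toLaurent_aux (k := k) i)

theorem toLaurent_const (i : ℕ) (c : k) :
    toLaurent k i (const k c) = HahnSeries.C (const k c) := by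
  rw [toLaurent, const, RingHom.comp_apply, IsFractionRing.lift_algebraMap]
  simp [toPolynomial, const]

theorem toLaurent_var_self (i : ℕ) : toLaurent k i (var k i) = HahnSeries.single 1 1 := by
  rw [toLaurent, var, IsFractionRing.lift_algebraMap]
  simp [toPolynomial]

theorem toLaurent_var_of_ne {i j : ℕ} (h : j ≠ i) :
    toLaurent k i (var k j) = HahnSeries.C (var k j) := by
  conv_lhs => rw [toLaurent, var, IsFractionRing.lift_algebraMap]
  simp [toPolynomial, h]

/-- Expansion in `ξ_i` is natural for permutations of the variables. -/
theorem toLaurent_smul (σ : InfSymm) (i : ℕ) (a : RatField k) :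
    toLaurent k (σ • i) (σ • a) = laurentMap k σ (toLaurent k i a) := by
  obtain ⟨V, hV⟩ := exists_vars a
  refine hV ((toLaurent k (σ • i)).comp (smulHom k σ)) ((laurentMap k σ).comp (toLaurent k i))
    (fun c => ?_) (fun j _ => ?_)
  · rw [RingHom.comp_apply, RingHom.comp_apply, smulHom_apply, smul_const, toLaurent_const,
      toLaurent_const, laurentMap_C, smul_const]
  · rw [RingHom.comp_apply, RingHom.comp_apply, smulHom_apply, smul_var]
    by_cases h : j = i
    · subst h
      rw [toLaurent_var_self, toLaurent_var_self, laurentMap_single]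
    · rw [toLaurent_var_of_ne h, laurentMap_C, smul_var,
        toLaurent_var_of_ne fun h' => h (MulAction.injective σ h')]

/-- Swapping `i` with an index `j` that does not occur in `a` fixes `a`, so `a` can be rewritten
without `ξ_i`; the expansion then agrees with the constant embedding on every variable that is used.
-/
theorem toLaurent_eq_C {U : Finset ℕ} {i : ℕ} {a : RatField k} (ha : Supp U a) (hi : i ∉ U) :
    toLaurent k i a = HahnSeries.C a := by
  classical
  obtain ⟨V, hV⟩ := exists_vars a
  obtain ⟨j, hj⟩ := Infinite.exists_notMem_finset (V ∪ U)
  rw [Finset.mem_union, not_or] at hj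
  rw [← ha (swap i j) (swap_mem_fixator hi hj.2)]
  refine hV ((toLaurent k i).comp (smulHom k (swap i j)))
    (HahnSeries.C.comp (smulHom k (swap i j))) (fun c => ?_) (fun l hl => ?_)
  · rw [RingHom.comp_apply, RingHom.comp_apply, smulHom_apply, smul_const, toLaurent_const]
  · rw [RingHom.comp_apply, RingHom.comp_apply, smulHom_apply, smul_var, toLaurent_var_of_ne]
    intro h
    refine hj.1 (?_ : j ∈ V)
    have : l = j := MulAction.injective (swap i j) (h.trans (swap_smul_right i j).symm)
    exact this ▸ hl

/-- The coefficients of the expansion in `ξ_i`. -/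
noncomputable def laurentCoeff (k : Type u) [Field k] (i : ℕ) (n : ℤ) : RatField k →+ RatField k where
  toFun a := (toLaurent k i a).coeff n
  map_zero' := by simp
  map_add' a b := by simp

theorem laurentCoeff_apply (i : ℕ) (n : ℤ) (a : RatField k) :
    laurentCoeff k i n a = (toLaurent k i a).coeff n := rfl

theorem laurentCoeff_smul (σ : InfSymm) (i : ℕ) (n : ℤ) (a : RatField k) :
    laurentCoeff k (σ • i) n (σ • a) = σ • laurentCoeff k i n a := by
  rw [laurentCoeff_apply, toLaurent_smul]; rfl

theorem laurentCoeff_mul {U : Finset ℕ} {i : ℕ} {a : RatField k} (ha : Supp U a) (hi : i ∉ U)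
    (n : ℤ) (b : RatField k) : laurentCoeff k i n (a * b) = a * laurentCoeff k i n b := by
  rw [laurentCoeff_apply, map_mul, toLaurent_eq_C ha hi, HahnSeries.C_mul_eq_smul]; rfl

theorem laurentCoeff_zero_eq {U : Finset ℕ} {i : ℕ} {a : RatField k} (ha : Supp U a)
    (hi : i ∉ U) : laurentCoeff k i 0 a = a := by
  rw [laurentCoeff_apply, toLaurent_eq_C ha hi]
  simp

/-- The name of the expansion variable is immaterial: renaming `i` to a fresh `j` changes `a` but
not its coefficients. A coefficient is thus fixed by the swap of `i` and `j`, which carries a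
support containing `i` to one avoiding it. -/
theorem exists_supp_laurentCoeff (i : ℕ) (n : ℤ) (a : RatField k) :
    ∃ U : Finset ℕ, i ∉ U ∧ Supp U (laurentCoeff k i n a) := by
  classical
  obtain ⟨V, hV⟩ := exists_vars a
  obtain ⟨j, hj⟩ := Infinite.exists_notMem_finset (insert i V)
  have hsupp : Supp (insert i V) (laurentCoeff k i n a) := fun σ hσ => by
    rw [← laurentCoeff_smul, mem_fixator.1 hσ i (by simp)]
    congr 1
    refine hV (smulHom k σ) (RingHom.id _) (fun c => smul_const σ c) (fun l hl => ?_)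
    rw [smulHom_apply, smul_var, mem_fixator.1 hσ l (by simp [hl])]; rfl
  have h : swap i j • laurentCoeff k i n a = laurentCoeff k i n a := by
    rw [← laurentCoeff_smul, laurentCoeff_apply, laurentCoeff_apply, swap_smul_left]
    congr 1
    refine hV ((toLaurent k j).comp (smulHom k (swap i j))) (toLaurent k i) (fun c => ?_)
      (fun l hl => ?_)
    · rw [RingHom.comp_apply, smulHom_apply, smul_const, toLaurent_const, toLaurent_const]
    · rw [RingHom.comp_apply, smulHom_apply, smul_var]
      have hlj : l ≠ j := fun h => hj (by simp [← h, hl])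
      by_cases hli : l = i
      · rw [hli, swap_smul_left, toLaurent_var_self, toLaurent_var_self]
      · rw [swap_smul_of_ne hli hlj, toLaurent_var_of_ne hlj, toLaurent_var_of_ne hli]
  refine ⟨swap i j • insert i V, fun hi => hj ?_, h ▸ hsupp.smul _⟩
  obtain ⟨l, hl, hli⟩ := Finset.mem_smul_finset.1 hi
  have : l = j := MulAction.injective (swap i j) (hli.trans (swap_smul_right i j).symm)
  exact this ▸ hl

theorem exists_supp (a : RatField k) : ∃ V : Finset ℕ, Supp V a := by
  obtain ⟨n, hn⟩ := SmoothRep.ratField_smooth a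
  exact ⟨Finset.range n, fun σ hσ => hn σ (mem_fixator_range.1 hσ)⟩

end RatField

/-! ### Galois descent for the permutations of a finite set of variables -/

namespace InfSymm

variable {k : Type u} [Field k]

/-- The permutations of a finite set of indices, as elements of `𝔖`. -/
noncomputable def ofPerm (S : Finset ℕ) : Equiv.Perm S →* InfSymm where
  toFun τ := ⟨Equiv.Perm.ofSubtype τ, S.sup id + 1, fun i hi =>
    Equiv.Perm.ofSubtype_apply_of_not_mem τ fun h => by
      have := Finset.le_sup (f := id) h
      simp only [id] at this
      omega⟩
  map_one' := Subtype.ext (map_one _)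
  map_mul' σ τ := Subtype.ext (map_mul _ σ τ)

theorem ofPerm_smul {S : Finset ℕ} (τ : Equiv.Perm S) {i : ℕ} (hi : i ∈ S) :
    ofPerm S τ • i = τ ⟨i, hi⟩ := Equiv.Perm.ofSubtype_apply_of_mem τ hi

theorem ofPerm_smul_of_notMem {S : Finset ℕ} (τ : Equiv.Perm S) {i : ℕ} (hi : i ∉ S) :
    ofPerm S τ • i = i := Equiv.Perm.ofSubtype_apply_of_not_mem τ hi

theorem ofPerm_mem_fixator {S V : Finset ℕ} (h : Disjoint S V) (τ : Equiv.Perm S) :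
    ofPerm S τ ∈ fixator V :=
  mem_fixator.2 fun _ hi => ofPerm_smul_of_notMem τ (Finset.disjoint_right.1 h hi)

theorem smul_finset_eq_of_mem {S : Finset ℕ} {σ : InfSymm} (h : ∀ i ∈ S, σ • i ∈ S) :
    σ • S = S := by
  refine Finset.eq_of_subset_of_card_le (fun j hj => ?_) (Finset.card_smul_finset σ S).ge
  obtain ⟨i, hi, rfl⟩ := Finset.mem_smul_finset.1 hj
  exact h i hi

theorem ofPerm_mem_stabilizer {S : Finset ℕ} (τ : Equiv.Perm S) :
    ofPerm S τ ∈ MulAction.stabilizer InfSymm S :=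
  MulAction.mem_stabilizer_iff.2 (smul_finset_eq_of_mem fun i hi => by
    rw [ofPerm_smul τ hi]; exact (τ _).2)

theorem exists_ofPerm {S : Finset ℕ} {σ : InfSymm} (h : σ • S = S) :
    ∃ τ : Equiv.Perm S, ∀ i ∈ S, σ • i = ofPerm S τ • i := by
  have hmem : ∀ i, σ • i ∈ S ↔ i ∈ S := fun i => by
    conv_lhs => rw [← h]
    exact Finset.smul_mem_smul_finset_iff σ
  exact ⟨(σ : Equiv.Perm ℕ).subtypePerm hmem, fun i hi => by rw [ofPerm_smul _ hi]; rfl⟩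

section Galois

variable {S : Finset ℕ} {W : Type*} [AddCommGroup W] [Module (RatField k) W]
  [DistribMulAction (MulAction.stabilizer InfSymm S) W]

/-- Galois descent: in a semilinear representation of the stabilizer of `S`, a vector fixed by the
permutations fixing `V ∪ S` pointwise is a combination of vectors fixed by those that fix `V`
pointwise, and these can be found in any invariant subspace containing the given one. -/
theorem mem_span_invariants
    (hs : ∀ (h : MulAction.stabilizer InfSymm S) (a : RatField k) (w : W),
      h • (a • w) = ((h : InfSymm) • a) • (h • w))
    {V : Finset ℕ} (hSV : Disjoint S V) {N : Submodule (RatField k) W}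
    (hN : ∀ h : MulAction.stabilizer InfSymm S, (h : InfSymm) ∈ fixator V → ∀ w ∈ N, h • w ∈ N)
    {x : W} (hxN : x ∈ N)
    (hx : ∀ h : MulAction.stabilizer InfSymm S, (h : InfSymm) ∈ fixator (V ∪ S) → h • x = x) :
    x ∈ Submodule.span (RatField k)
      {y : W | y ∈ N ∧ ∀ h : MulAction.stabilizer InfSymm S, (h : InfSymm) ∈ fixator V → h • y = y} := by
  classical
  let p : Equiv.Perm S → MulAction.stabilizer InfSymm S := fun τ => ⟨_, ofPerm_mem_stabilizer τ⟩
  -- The rational functions supported by `S`. The permutations of `S` are multiplicative characters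
  -- on them, to which Dedekind's independence theorem applies.
  let A : Submonoid (RatField k) :=
    { carrier := {a | Supp S a}
      one_mem' := fun σ _ => smul_one σ
      mul_mem' := fun {a b} ha hb σ hσ => by rw [smul_mul', ha σ hσ, hb σ hσ] }
  let χ : Equiv.Perm S → (A →* RatField k) := fun τ =>
    (RatField.smulHom k (ofPerm S τ) : RatField k →* RatField k).comp A.subtype
  have hχ : Function.Injective χ := fun τ τ' h => by
    refine Equiv.ext fun i => Subtype.ext ?_
    have := DFunLike.congr_fun h (⟨RatField.var k i, (RatField.supp_var (i : ℕ)).mono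
      (by simp)⟩ : A)
    change ofPerm S τ • RatField.var k i = ofPerm S τ' • RatField.var k i at this
    rw [RatField.smul_var, RatField.smul_var, ofPerm_smul _ i.2, ofPerm_smul _ i.2] at this
    exact RatField.var_injective this
  have hlin : LinearIndependent (RatField k) fun τ => (χ τ : A → RatField k) :=
    (linearIndependent_monoidHom A (RatField k)).comp χ hχ
  -- The traces of the multiples `a • x`, which are the invariants that will span.
  have hinv : ∀ a : A, (∑ τ, p τ • ((a : RatField k) • x)) ∈
      {y : W | y ∈ N ∧ ∀ h : MulAction.stabilizer InfSymm S, (h : InfSymm) ∈ fixator V → h • y = y} := by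
    refine fun a => ⟨sum_mem fun τ _ => hN _ (ofPerm_mem_fixator hSV τ) _
      (N.smul_mem _ hxN), fun h hh => ?_⟩
    obtain ⟨τ₀, hτ₀⟩ := exists_ofPerm (MulAction.mem_stabilizer_iff.1 h.2)
    rw [Finset.smul_sum]
    refine Fintype.sum_equiv (Equiv.mulLeft τ₀) _ _ fun τ => ?_
    rw [← mul_smul, ← inv_smul_eq_iff, ← mul_smul]
    -- On `S`, `h` acts as `τ₀`; so this product fixes `S` pointwise, and it fixes `V` because each
    -- factor does. It therefore fixes both `x` and `a`.
    have hmem : (((p (Equiv.mulLeft τ₀ τ))⁻¹ * (h * p τ) : MulAction.stabilizer InfSymm S) :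
        InfSymm) ∈ fixator (V ∪ S) := by
      change (ofPerm S (τ₀ * τ))⁻¹ * (h * ofPerm S τ) ∈ _
      rw [mem_fixator_union]
      refine ⟨mul_mem (inv_mem (ofPerm_mem_fixator hSV _))
        (mul_mem hh (ofPerm_mem_fixator hSV _)), mem_fixator.2 fun i hi => ?_⟩
      rw [mul_smul, inv_smul_eq_iff, mul_smul, map_mul, mul_smul]
      exact hτ₀ _ (by rw [ofPerm_smul _ hi]; exact (τ _).2)
    rw [hs, hx _ hmem, a.2 _ (mem_fixator_union.1 hmem).2]
  -- A functional `f` killing all traces gives a linear relation between the characters with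
  -- coefficients `f (τ x)`; independence makes the coefficient `f x` at `τ = 1` vanish.
  by_contra hnot
  obtain ⟨f, hf, hker⟩ := Submodule.exists_le_ker_of_notMem hnot
  have h0 : ∑ τ, f (p τ • x) • (χ τ : A → RatField k) = 0 := by
    ext a
    have := LinearMap.mem_ker.1 (hker (Submodule.subset_span (hinv a)))
    rw [map_sum] at this
    rw [Finset.sum_apply, Pi.zero_apply, ← this]
    refine Finset.sum_congr rfl fun τ _ => ?_
    rw [hs, LinearMap.map_smul, Pi.smul_apply]
    exact mul_comm _ _
  have := Fintype.linearIndependent_iff.1 hlin _ h0 1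
  refine hf ?_
  rwa [show p 1 = 1 from Subtype.ext (map_one (ofPerm S)), one_smul] at this

end Galois

end InfSymm

/-! ### Subspaces of bounded degree -/

namespace SmoothRep

open InfSymm

variable {k : Type u} [Field k] {M : SmoothRep k}

theorem exists_supp (v : M) : ∃ V : Finset ℕ, Supp V v := by
  obtain ⟨n, hn⟩ := M.smooth v
  exact ⟨Finset.range n, fun σ hσ => hn σ (mem_fixator_range.1 hσ)⟩

theorem exists_supp_of_finite {X : Set M} (hX : X.Finite) :
    ∃ V : Finset ℕ, ∀ x ∈ X, Supp V x := by
  have h : ∀ᶠ V : Finset ℕ in Filter.atTop, ∀ x ∈ X, Supp V x :=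
    (Filter.eventually_all_finite hX).2 fun x _ => by
      obtain ⟨V, hV⟩ := exists_supp x
      exact Filter.eventually_atTop.2 ⟨V, fun W hW => hV.mono hW⟩
  exact h.exists

theorem supp_add {V : Finset ℕ} {x y : M} (hx : Supp V x) (hy : Supp V y) : Supp V (x + y) :=
  fun σ hσ => by rw [smul_add, hx σ hσ, hy σ hσ]

theorem supp_smul {V : Finset ℕ} {a : RatField k} {x : M} (ha : Supp V a) (hx : Supp V x) :
    Supp V (a • x) :=
  fun σ hσ => by rw [M.semilinear, ha σ hσ, hx σ hσ]

/-- A subspace stable under a subgroup of `𝔖`. -/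
def Stable (H : Subgroup InfSymm) (N : Submodule (RatField k) M) : Prop :=
  ∀ σ ∈ H, ∀ x ∈ N, σ • x ∈ N

theorem Stable.mono {H H' : Subgroup InfSymm} {N : Submodule (RatField k) M} (h : Stable H N)
    (hH : H' ≤ H) : Stable H' N := fun σ hσ => h σ (hH hσ)

theorem Stable.inf {H : Subgroup InfSymm} {N N' : Submodule (RatField k) M} (h : Stable H N)
    (h' : Stable H N') : Stable H (N ⊓ N') := fun σ hσ x hx => ⟨h σ hσ x hx.1, h' σ hσ x hx.2⟩

theorem Stable.sup {H : Subgroup InfSymm} {N N' : Submodule (RatField k) M} (h : Stable H N)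
    (h' : Stable H N') : Stable H (N ⊔ N') := fun σ hσ x hx => by
  obtain ⟨y, hy, z, hz, rfl⟩ := Submodule.mem_sup.1 hx
  rw [smul_add]
  exact Submodule.add_mem_sup (h σ hσ y hy) (h' σ hσ z hz)

theorem smul_mem_of_mem_span {Y : Set M} {N : Submodule (RatField k) M} {σ : InfSymm}
    (h : ∀ y ∈ Y, σ • y ∈ N) {x : M} (hx : x ∈ Submodule.span (RatField k) Y) : σ • x ∈ N := by
  induction hx using Submodule.span_induction with
  | mem y hy => exact h y hy
  | zero => rw [smul_zero]; exact N.zero_mem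
  | add y z _ _ hy hz => rw [smul_add]; exact N.add_mem hy hz
  | smul a y _ hy => rw [M.semilinear]; exact N.smul_mem _ hy

/-- The union of the `P`-translates of `X`. -/
def translates (P : Set InfSymm) (X : Set M) : Set M := {y | ∃ σ ∈ P, ∃ x ∈ X, y = σ • x}

theorem smul_mem_translates {P : Set InfSymm} {X : Set M} {σ : InfSymm} {x : M} (hσ : σ ∈ P)
    (hx : x ∈ X) : σ • x ∈ Submodule.span (RatField k) (translates P X) :=
  Submodule.subset_span ⟨σ, hσ, x, hx, rfl⟩

theorem stable_span_translates {H : Subgroup InfSymm} {P : Set InfSymm} {X : Set M}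
    (h : ∀ σ ∈ H, ∀ τ ∈ P, σ * τ ∈ P) :
    Stable H (Submodule.span (RatField k) (translates P X)) := fun σ hσ x hx =>
  smul_mem_of_mem_span (by
    rintro _ ⟨τ, hτ, y, hy, rfl⟩
    rw [← mul_smul]
    exact smul_mem_translates (h σ hσ τ hτ) hy) hx

theorem span_translates_le {H : Subgroup InfSymm} {X : Set M} {N : Submodule (RatField k) M}
    (hN : Stable H N) (hX : X ⊆ N) : Submodule.span (RatField k) (translates H X) ≤ N :=
  Submodule.span_le.2 (by
    rintro _ ⟨σ, hσ, x, hx, rfl⟩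
    exact hN σ hσ x (hX hx))

theorem span_le_span_translates {H : Subgroup InfSymm} {X : Set M} :
    Submodule.span (RatField k) X ≤ Submodule.span (RatField k) (translates H X) :=
  Submodule.span_le.2 fun x hx => by
    simpa using smul_mem_translates (k := k) (one_mem H) hx

/-- The subspace `N` is spanned by the `𝔖_V`-orbits of finitely many vectors, each of which is
supported by the union of `V` and a set of fewer than `d` indices. -/
def Bounded (V : Finset ℕ) (d : ℕ) (N : Submodule (RatField k) M) : Prop :=
  ∃ X : Set M, X.Finite ∧ (∀ x ∈ X, ∃ U : Finset ℕ, U.card < d ∧ Supp (V ∪ U) x) ∧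
    N = Submodule.span (RatField k) (translates (fixator V : Set InfSymm) X)

theorem Bounded.stable {V : Finset ℕ} {d : ℕ} {N : Submodule (RatField k) M}
    (h : Bounded V d N) : Stable (fixator V) N := by
  obtain ⟨X, -, -, rfl⟩ := h
  exact stable_span_translates fun σ hσ τ hτ => mul_mem hσ hτ

theorem bounded_zero {V : Finset ℕ} {N : Submodule (RatField k) M} (h : Bounded V 0 N) :
    N = ⊥ := by
  obtain ⟨X, -, hX, rfl⟩ := h
  rw [Submodule.span_eq_bot]
  rintro _ ⟨σ, -, x, hx, rfl⟩
  obtain ⟨U, hU, -⟩ := hX x hx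
  exact (Nat.not_lt_zero _ hU).elim

/-- A translate `σ • x` depends only on `σ` on a support of `x`, so up to 𝔖_V only finitely many
occur (`exists_finite_reps`). This turns an infinite family of translates into a finite set of
generators. -/
theorem bounded_span_translates {P : Set InfSymm} {X : Set M} (hX : X.Finite) {V : Finset ℕ}
    {d : ℕ} (hP : ∀ σ ∈ fixator V, ∀ τ ∈ P, σ * τ ∈ P)
    (h : ∀ σ ∈ P, ∀ x ∈ X, ∃ U : Finset ℕ, U.card < d ∧ Supp (V ∪ U) (σ • x)) :
    Bounded V d (Submodule.span (RatField k) (translates P X)) := by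
  obtain ⟨W, hW⟩ := exists_supp_of_finite hX
  obtain ⟨F, hFP, hF, hrep⟩ := exists_finite_reps P V W
  refine ⟨Set.image2 (fun σ x => σ • x) F X, hF.image2 _ hX, ?_, le_antisymm ?_ ?_⟩
  · rintro _ ⟨σ, hσ, x, hx, rfl⟩
    exact h σ (hFP hσ) x hx
  · refine Submodule.span_le.2 ?_
    rintro _ ⟨σ, hσ, x, hx, rfl⟩
    obtain ⟨τ, hτ, ρ, hρ, hστ⟩ := hrep σ hσ
    rw [(hW x hx).smul_eq (τ := ρ * τ) fun w hw => by rw [mul_smul]; exact hστ w hw, mul_smul]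
    exact smul_mem_translates hρ ⟨τ, hτ, x, hx, rfl⟩
  · refine Submodule.span_le.2 ?_
    rintro _ ⟨ρ, hρ, _, ⟨σ, hσ, x, hx, rfl⟩, rfl⟩
    rw [← mul_smul]
    exact smul_mem_translates (hP ρ hρ σ (hFP hσ)) hx

theorem supp_smul_union {V U : Finset ℕ} {x : M} {σ : InfSymm} (hσ : σ ∈ fixator V)
    (hx : Supp (V ∪ U) x) : Supp (V ∪ σ • U) (σ • x) := by
  have := hx.smul σ
  rwa [Finset.smul_finset_union, smul_finset_eq_self hσ] at this

theorem Bounded.mono {V V' : Finset ℕ} {d : ℕ} {N : Submodule (RatField k) M}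
    (h : Bounded V d N) (hV : V ⊆ V') : Bounded V' d N := by
  obtain ⟨X, hX, hU, rfl⟩ := h
  refine bounded_span_translates hX (fun σ hσ τ hτ => mul_mem (fixator_anti hV hσ) hτ) ?_
  intro σ hσ x hx
  obtain ⟨U, hU, hsupp⟩ := hU x hx
  exact ⟨σ • U, by rwa [Finset.card_smul_finset],
    (supp_smul_union hσ hsupp).mono (Finset.union_subset_union_left hV)⟩

theorem Bounded.mono_right {V : Finset ℕ} {d d' : ℕ} {N : Submodule (RatField k) M}
    (h : Bounded V d N) (hd : d ≤ d') : Bounded V d' N := by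
  obtain ⟨X, hX, hU, rfl⟩ := h
  refine ⟨X, hX, fun x hx => ?_, rfl⟩
  obtain ⟨U, hU, hsupp⟩ := hU x hx
  exact ⟨U, hU.trans_le hd, hsupp⟩

theorem Bounded.sup {V : Finset ℕ} {d : ℕ} {N N' : Submodule (RatField k) M}
    (h : Bounded V d N) (h' : Bounded V d N') : Bounded V d (N ⊔ N') := by
  obtain ⟨X, hX, hU, rfl⟩ := h
  obtain ⟨X', hX', hU', rfl⟩ := h'
  refine ⟨X ∪ X', hX.union hX', fun x hx => hx.elim (hU x) (hU' x), ?_⟩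
  rw [← Submodule.span_union]
  congr 1
  ext y
  constructor
  · rintro (⟨σ, hσ, x, hx, rfl⟩ | ⟨σ, hσ, x, hx, rfl⟩)
    · exact ⟨σ, hσ, x, Or.inl hx, rfl⟩
    · exact ⟨σ, hσ, x, Or.inr hx, rfl⟩
  · rintro ⟨σ, hσ, x, hx | hx, rfl⟩
    · exact Or.inl ⟨σ, hσ, x, hx, rfl⟩
    · exact Or.inr ⟨σ, hσ, x, hx, rfl⟩

/-- The generators of a bounded subspace can be taken invariant under the setwise stabilizer of a
given set of indices. -/
theorem Bounded.exists_invariant_generators {V : Finset ℕ} {d : ℕ} {N : Submodule (RatField k) M}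
    (h : Bounded V (d + 1) N) {S : Finset ℕ} (hS : S.card = d) (hSV : Disjoint S V) :
    ∃ X : Set M, X.Finite ∧ (∀ x ∈ X, ∀ σ ∈ fixator V, σ • S = S → σ • x = x) ∧
      N = Submodule.span (RatField k) (translates (fixator V : Set InfSymm) X) := by
  classical
  have hN := h.stable
  obtain ⟨X, hX, hU, rfl⟩ := h
  set N := Submodule.span (RatField k) (translates (fixator V : Set InfSymm) X) with hNdef
  have key : ∀ x ∈ X, ∃ t : Set M, t.Finite ∧ t ⊆ N ∧
      (∀ y ∈ t, ∀ σ ∈ fixator V, σ • S = S → σ • y = y) ∧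
      ∃ σ ∈ fixator V, σ • x ∈ Submodule.span (RatField k) t := by
    intro x hx
    obtain ⟨U, hU, hsupp⟩ := hU x hx
    -- The support beyond `V` is padded to exactly `d` indices, so that an element of 𝔖_V can move
    -- it onto `S`.
    obtain ⟨T, hUT, hT, hTV⟩ := exists_superset_disjoint_card (V := V) (U := U \ V) (d := d)
      ((Finset.card_le_card Finset.sdiff_subset).trans (Nat.lt_succ_iff.1 hU))
      Finset.sdiff_disjoint
    obtain ⟨σ, hσ, hσT⟩ := exists_smul_finset_eq hTV hSV (hT.trans hS.symm)
    have hσx : Supp (V ∪ S) (σ • x) := by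
      rw [← hσT]
      refine supp_smul_union hσ (hsupp.mono ?_)
      intro i hi
      by_cases hiV : i ∈ V
      · exact Finset.mem_union_left _ hiV
      · exact Finset.mem_union_right _ (hUT (Finset.mem_sdiff.2
          ⟨(Finset.mem_union.1 hi).resolve_left hiV, hiV⟩))
    -- Descent inside `N` itself, so that the new generators stay in `N`.
    have hmem := mem_span_invariants (k := k) (S := S) (W := M)
      (fun h a w => M.semilinear h a w) hSV (N := N) (fun h hh w hw => hN h hh w hw)
      (x := σ • x) (smul_mem_translates hσ hx) (fun h hh => hσx h hh)
    obtain ⟨t, ht, hxt⟩ := Submodule.mem_span_finite_of_mem_span hmem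
    refine ⟨t, t.finite_toSet, fun y hy => (ht hy).1, fun y hy τ hτ hτS => (ht hy).2
      ⟨τ, MulAction.mem_stabilizer_iff.2 hτS⟩ hτ, σ, hσ, hxt⟩
  choose! t htf htN htinv σ hσ hxt using key
  refine ⟨⋃ x ∈ X, t x, hX.biUnion htf, ?_, le_antisymm ?_ ?_⟩
  · intro y hy
    obtain ⟨x, hx, hy⟩ := Set.mem_iUnion₂.1 hy
    exact htinv x hx y hy
  · refine span_translates_le (stable_span_translates fun σ hσ τ hτ => mul_mem hσ hτ) ?_
    intro x hx
    have h1 : σ x • x ∈ Submodule.span (RatField k)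
        (translates (fixator V : Set InfSymm) (⋃ x ∈ X, t x)) :=
      span_le_span_translates (Submodule.span_mono (Set.subset_biUnion_of_mem hx) (hxt x hx))
    have h2 := stable_span_translates (H := fixator V) (fun σ hσ τ hτ => mul_mem hσ hτ) (σ x)⁻¹
      (inv_mem (hσ x hx)) _ h1
    rwa [inv_smul_smul] at h2
  · exact span_translates_le hN (Set.iUnion₂_subset htN)

end SmoothRep

/-! ### Decomposition in top degree; noetherianity and extension of maps -/

namespace SmoothRep

open InfSymm

variable {k : Type u} [Field k] {M : SmoothRep k}

theorem translates_mono {P Q : Set InfSymm} (h : P ⊆ Q) (X : Set M) :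
    translates P X ⊆ translates Q X := fun _ ⟨σ, hσ, x, hx, hy⟩ => ⟨σ, h hσ, x, hx, hy⟩

/-- A vector of the span of translates involves only finitely many translates. -/
theorem exists_finset_mem_span_translates {P : Set InfSymm} {X : Set M} (S : Finset ℕ) {e : M}
    (he : e ∈ Submodule.span (RatField k) (translates P X)) :
    ∃ W : Finset ℕ, ∀ W', W ⊆ W' →
      e ∈ Submodule.span (RatField k) (translates {σ | σ ∈ P ∧ σ • S ⊆ W'} X) := by
  classical
  induction he using Submodule.span_induction with
  | mem y hy =>
    obtain ⟨σ, hσ, x, hx, rfl⟩ := hy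
    exact ⟨σ • S, fun W' hW => smul_mem_translates ⟨hσ, hW⟩ hx⟩
  | zero => exact ⟨∅, fun _ _ => Submodule.zero_mem _⟩
  | add y z _ _ hy hz =>
    obtain ⟨W₁, h₁⟩ := hy
    obtain ⟨W₂, h₂⟩ := hz
    exact ⟨W₁ ∪ W₂, fun W' hW => Submodule.add_mem _
      (h₁ W' (Finset.subset_union_left.trans hW)) (h₂ W' (Finset.subset_union_right.trans hW))⟩
  | smul a y _ hy =>
    obtain ⟨W, hW⟩ := hy
    exact ⟨W, fun W' h => Submodule.smul_mem _ a (hW W' h)⟩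

theorem not_disjoint_smul {S V : Finset ℕ} {σ ρ : InfSymm} (hρ : ρ ∈ fixator V)
    (h : ¬Disjoint (σ • S) V) : ¬Disjoint ((ρ * σ) • S) V := by
  rw [Finset.not_disjoint_iff] at h ⊢
  obtain ⟨i, hi, hiV⟩ := h
  refine ⟨i, ?_, hiV⟩
  rw [mul_smul, ← mem_fixator.1 hρ i hiV]
  exact Finset.smul_mem_smul_finset hi

/-- If `Z` spans a subspace disjoint from `E`, its translates by elements moving `S` lie in `E`,
and `Z` is invariant under the setwise stabilizer of `S`, then no nonzero vector in the span of the
orbits of `Z` has all its translates in `E`. -/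
theorem eq_zero_of_translates_mem {V S : Finset ℕ} {Z : Set M} {E : Submodule (RatField k) M}
    (hZ : ∀ z ∈ Z, ∀ σ ∈ fixator V, σ • S = S → σ • z = z)
    (hZE : Disjoint (Submodule.span (RatField k) Z) E)
    (hE : ∀ z ∈ Z, ∀ σ ∈ fixator V, σ • S ≠ S → σ • z ∈ E) {c : M}
    (hc : c ∈ Submodule.span (RatField k) (translates (fixator V : Set InfSymm) Z))
    (hcE : ∀ τ ∈ fixator V, τ • c ∈ E) : c = 0 := by
  classical
  -- The translates are sorted by the position `T = σ • S`. Among these pieces, `C S` lies in the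
  -- span of `Z` and all the others lie in `E`.
  let C : Finset ℕ → Submodule (RatField k) M := fun T =>
    Submodule.span (RatField k) (translates {σ | σ ∈ fixator V ∧ σ • S = T} Z)
  have hle : Submodule.span (RatField k) (translates (fixator V : Set InfSymm) Z) ≤ ⨆ T, C T :=
    Submodule.span_le.2 (by
      rintro _ ⟨σ, hσ, z, hz, rfl⟩
      exact Submodule.mem_iSup_of_mem (σ • S) (smul_mem_translates ⟨hσ, rfl⟩ hz))
  obtain ⟨f, hf, rfl⟩ := (Submodule.mem_iSup_iff_exists_finsupp C c).1 (hle hc)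
  have hmove : ∀ (τ : InfSymm), τ ∈ fixator V → ∀ T, ∀ x ∈ C T, τ • x ∈ C (τ • T) := by
    intro τ hτ T x hx
    refine smul_mem_of_mem_span ?_ hx
    rintro _ ⟨σ, ⟨hσ, hσT⟩, z, hz, rfl⟩
    rw [← mul_smul]
    exact smul_mem_translates ⟨mul_mem hτ hσ, by rw [mul_smul, hσT]⟩ hz
  have hCS : C S ≤ Submodule.span (RatField k) Z := Submodule.span_le.2 (by
    rintro _ ⟨σ, ⟨hσ, hσS⟩, z, hz, rfl⟩
    rw [hZ z hz σ hσ hσS]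
    exact Submodule.subset_span hz)
  have hCE : ∀ T, T ≠ S → C T ≤ E := fun T hT => Submodule.span_le.2 (by
    rintro _ ⟨σ, ⟨hσ, hσS⟩, z, hz, rfl⟩
    exact hE z hz σ hσ (hσS ▸ hT))
  refine Finset.sum_eq_zero fun T hT => ?_
  by_cases hTS : ∃ σ ∈ fixator V, σ • S = T
  swap
  · have h : C T = ⊥ := by
      rw [Submodule.span_eq_bot]
      rintro _ ⟨σ, ⟨hσ, hσT⟩, z, hz, rfl⟩
      exact (hTS ⟨σ, hσ, hσT⟩).elim
    exact (Submodule.mem_bot _).1 (h ▸ hf T)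
  obtain ⟨σ, hσ, rfl⟩ := hTS
  -- Applying `σ⁻¹` brings the chosen component to position `S` and every other component into `E`;
  -- so it lies in `E` and in the span of `Z`, which are disjoint.
  have hinv := inv_mem hσ
  have h1 : σ⁻¹ • f (σ • S) ∈ Submodule.span (RatField k) Z := by
    have := hmove _ hinv _ _ (hf (σ • S))
    rw [inv_smul_smul] at this
    exact hCS this
  have h2 : σ⁻¹ • f (σ • S) ∈ E := by
    have h := hcE _ hinv
    rw [Finsupp.sum, Finset.smul_sum, ← Finset.add_sum_erase _ _ hT] at h
    refine (Submodule.add_mem_iff_left E (sum_mem fun T' hT' => ?_)).1 h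
    refine hCE (σ⁻¹ • T') ?_ (hmove _ hinv _ _ (hf T'))
    rw [Ne, inv_smul_eq_iff]
    exact (Finset.mem_erase.1 hT').1
  have := Submodule.disjoint_def.1 hZE _ h1 h2
  rwa [inv_smul_eq_iff, smul_zero] at this

/-- Modulo a stable subspace and subspaces of smaller degree, a bounded subspace becomes free after
restriction to some `𝔖_{V₀}`. -/
theorem Bounded.exists_decomposition {V : Finset ℕ} {d : ℕ} {N A : Submodule (RatField k) M}
    (hN : Bounded V (d + 1) N) (hA : Stable (fixator V) A) :
    ∃ (S V₀ : Finset ℕ) (N₀ P C E : Submodule (RatField k) M), S.card = d ∧ V ⊆ V₀ ∧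
      Bounded V₀ d N₀ ∧ N₀ ≤ N ∧ Bounded V₀ (d + 1) P ∧ P ≤ A ∧ Stable (fixator V₀) C ∧ C ≤ N ∧
      N ≤ P ⊔ N₀ ⊔ C ∧ A ≤ E ∧ N₀ ≤ E ∧ (∀ c ∈ C, (∀ τ ∈ fixator V₀, τ • c ∈ E) → c = 0) ∧
      ∀ m ∈ N, ∀ U : Finset ℕ, ¬S ⊆ U → Supp U m → m ∈ E := by
  classical
  obtain ⟨S, hS, hSV⟩ := exists_disjoint_card V d
  obtain ⟨X, hX, hinv, rfl⟩ := hN.exists_invariant_generators hS hSV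
  have hsame : ∀ x ∈ X, ∀ σ ∈ fixator V, ∀ τ ∈ fixator V, σ • S = τ • S → σ • x = τ • x := by
    intro x hx σ hσ τ hτ h
    rw [← inv_smul_eq_iff, ← mul_smul]
    refine hinv x hx _ (mul_mem (inv_mem hτ) hσ) ?_
    rw [mul_smul, h, inv_smul_smul]
  let P' : Set InfSymm := {σ | σ ∈ fixator V ∧ σ • S ≠ S}
  let Y : Submodule (RatField k) M := Submodule.span (RatField k) (translates P' X)
  let E : Submodule (RatField k) M := A ⊔ Y
  -- `Z` is a part of `X` that is a basis modulo `E` of what `X` spans; each generator is thus a sum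
  -- `z + a + e` with `a` in `A` and `e` involving only positions other than `S`.
  obtain ⟨Z, hZX, -, hZspan, hZlin⟩ := exists_linearIndepOn_extension (K := RatField k)
    (v := E.mkQ) (linearIndepOn_empty _ _) (Set.empty_subset X)
  have hZE : Disjoint (Submodule.span (RatField k) Z) E := by
    have h := Submodule.range_ker_disjoint (f := E.mkQ) (v := fun z : Z => (z : M)) hZlin
    rwa [Subtype.range_coe, Submodule.ker_mkQ] at h
  have hdec : ∀ y ∈ X, ∃ z a e : M, z ∈ Submodule.span (RatField k) Z ∧ a ∈ A ∧ e ∈ Y ∧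
      y = z + a + e := by
    intro y hy
    have h1 := hZspan ⟨y, hy, rfl⟩
    rw [Submodule.span_image, SetLike.mem_coe, Submodule.mem_map] at h1
    obtain ⟨z, hz, hzy⟩ := h1
    have h2 : y - z ∈ E := by
      rw [← Submodule.ker_mkQ E, LinearMap.mem_ker, map_sub, hzy, sub_self]
    obtain ⟨a, ha, e, he, hae⟩ := Submodule.mem_sup.1 h2
    exact ⟨z, a, e, hz, ha, he, by rw [add_assoc, hae]; abel⟩
  choose! z a e hz ha he hzae using hdec
  -- `W` is taken large enough to support all corrections `a y` and to contain all positions used by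
  -- the `e y`.
  obtain ⟨W, hW⟩ : ∃ W : Finset ℕ, V ⊆ W ∧ (∀ y ∈ X, Supp W (a y)) ∧ ∀ y ∈ X,
      e y ∈ Submodule.span (RatField k) (translates {σ | σ ∈ P' ∧ σ • S ⊆ W} X) := by
    have h1 : ∀ᶠ W : Finset ℕ in Filter.atTop, ∀ y ∈ X, Supp W (a y) :=
      (Filter.eventually_all_finite hX).2 fun y _ => by
        obtain ⟨U, hU⟩ := exists_supp (a y)
        exact Filter.eventually_atTop.2 ⟨U, fun W hW => hU.mono hW⟩
    have h2 : ∀ᶠ W : Finset ℕ in Filter.atTop, ∀ y ∈ X,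
        e y ∈ Submodule.span (RatField k) (translates {σ | σ ∈ P' ∧ σ • S ⊆ W} X) :=
      (Filter.eventually_all_finite hX).2 fun y hy => by
        obtain ⟨U, hU⟩ := exists_finset_mem_span_translates S (he y hy)
        exact Filter.eventually_atTop.2 ⟨U, hU⟩
    exact ((Filter.eventually_ge_atTop V).and (h1.and h2)).exists
  obtain ⟨hVW, hWa, hWe⟩ := hW
  -- `S` is removed so that it stays disjoint from `V₀` and remains a possible position for the new
  -- base.
  let V₀ := W \ S
  have hVV₀ : V ⊆ V₀ := fun i hi => Finset.mem_sdiff.2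
    ⟨hVW hi, Finset.disjoint_right.1 hSV hi⟩
  have hSV₀ : Disjoint S V₀ := Finset.disjoint_sdiff
  have hWV₀ : W ⊆ V₀ ∪ S := by rw [Finset.sdiff_union_self_eq_union]; exact Finset.subset_union_left
  have hfix : fixator V₀ ≤ fixator V := fixator_anti hVV₀
  let Q : Set InfSymm := {σ | σ ∈ fixator V ∧ ¬Disjoint (σ • S) V₀}
  let N₀ : Submodule (RatField k) M := Submodule.span (RatField k) (translates Q X)
  let P : Submodule (RatField k) M :=
    Submodule.span (RatField k) (translates (fixator V₀ : Set InfSymm) (a '' X))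
  let C : Submodule (RatField k) M :=
    Submodule.span (RatField k) (translates (fixator V₀ : Set InfSymm) Z)
  have hQ : ∀ σ ∈ fixator V₀, ∀ τ ∈ Q, σ * τ ∈ Q := fun σ hσ τ hτ =>
    ⟨mul_mem (hfix hσ) hτ.1, not_disjoint_smul hσ hτ.2⟩
  have hQP' : Q ⊆ P' := fun σ hσ => ⟨hσ.1, fun h => hσ.2 (by rwa [h])⟩
  have hN₀ : Stable (fixator V₀) N₀ := stable_span_translates hQ
  have hC : Stable (fixator V₀) C := stable_span_translates fun σ hσ τ hτ => mul_mem hσ hτ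
  have hsuppX : ∀ x ∈ X, Supp (V ∪ S) x := fun x hx σ hσ =>
    hinv x hx σ (mem_fixator_union.1 hσ).1 (smul_finset_eq_self (mem_fixator_union.1 hσ).2)
  refine ⟨S, V₀, N₀, P, C, E, hS, hVV₀, ?_, ?_, ?_, ?_, hC, ?_, ?_, le_sup_left, ?_, ?_, ?_⟩
  -- The degree drops: `σ • S` meets `V₀`, so fewer than `d` of its indices are new.
  · refine bounded_span_translates hX hQ fun σ hσ x hx => ⟨σ • S \ V₀, ?_, ?_⟩
    · rw [← hS, ← Finset.card_smul_finset σ S]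
      refine Finset.card_lt_card (Finset.sdiff_subset.ssubset_of_ne fun h => hσ.2 ?_)
      exact h ▸ Finset.sdiff_disjoint
    · refine (supp_smul_union hσ.1 (hsuppX x hx)).mono ?_
      rw [Finset.union_sdiff_self_eq_union]
      exact Finset.union_subset_union_left hVV₀
  · exact Submodule.span_mono (translates_mono (fun σ hσ => hσ.1) X)
  · refine ⟨a '' X, hX.image a, ?_, rfl⟩
    rintro _ ⟨x, hx, rfl⟩
    exact ⟨S, by omega, (hWa x hx).mono hWV₀⟩
  · refine span_translates_le (hA.mono hfix) ?_
    rintro _ ⟨x, hx, rfl⟩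
    exact ha x hx
  · refine Submodule.span_mono ?_
    rintro _ ⟨σ, hσ, x, hx, rfl⟩
    exact ⟨σ, hfix hσ, x, hZX hx, rfl⟩
  -- A position contained in `W ⊆ V₀ ∪ S`, of the size of `S` but different from it, must meet `V₀`.
  · have heN₀ : ∀ y ∈ X, e y ∈ N₀ := fun y hy => by
      refine Submodule.span_mono (translates_mono ?_ X) (hWe y hy)
      rintro σ ⟨hσ, hσW⟩
      refine ⟨hσ.1, fun hdis => hσ.2 ?_⟩
      refine Finset.eq_of_subset_of_card_le (fun i hi => ?_) (Finset.card_smul_finset σ S).ge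
      exact (Finset.mem_union.1 (hWV₀ (hσW hi))).resolve_left (Finset.disjoint_left.1 hdis hi)
    refine Submodule.span_le.2 ?_
    rintro _ ⟨σ, hσ, y, hy, rfl⟩
    -- If the position avoids `V₀`, it is `τ • S` for some `τ` fixing `V₀`, and invariance gives `σ
    -- • y = τ • y`; the decomposition of `y` is then moved by `τ`. Otherwise the translate is in
    -- `N₀`.
    by_cases hd : Disjoint (σ • S) V₀
    · obtain ⟨τ, hτ, hτS⟩ := exists_smul_finset_eq hSV₀ hd (Finset.card_smul_finset σ S).symm
      rw [hsame y hy σ hσ τ (hfix hτ) hτS.symm, hzae y hy, smul_add, smul_add]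
      refine add_mem (add_mem ?_ ?_) ?_
      · exact Submodule.mem_sup_right (hC τ hτ _ (span_le_span_translates (hz y hy)))
      · exact Submodule.mem_sup_left (Submodule.mem_sup_left
          (smul_mem_translates hτ ⟨y, hy, rfl⟩))
      · exact Submodule.mem_sup_left (Submodule.mem_sup_right (hN₀ τ hτ _ (heN₀ y hy)))
    · exact Submodule.mem_sup_left (Submodule.mem_sup_right (smul_mem_translates ⟨hσ, hd⟩ hy))
  · exact le_sup_of_le_right (Submodule.span_mono (translates_mono hQP' X))
  · intro c hc hcE
    refine eq_zero_of_translates_mem (fun z hz σ hσ => hinv z (hZX hz) σ (hfix hσ)) hZE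
      (fun z hz σ hσ hσS => ?_) hc hcE
    exact Submodule.mem_sup_right (smul_mem_translates ⟨hfix hσ, hσS⟩ (hZX hz))
  · intro m hm U hSU hU
    obtain ⟨i, hiS, hiU⟩ := Finset.not_subset.1 hSU
    obtain ⟨W', hW'⟩ := exists_finset_mem_span_translates S hm
    -- With `i` in `S` but not in `U`, the swap of `i` and `j` fixes `m`, yet takes no position
    -- occurring in `m` to `S`: such a position would contain `j`.
    obtain ⟨j, hj⟩ := Infinite.exists_notMem_finset (W' ∪ (U ∪ V))
    simp only [Finset.mem_union, not_or] at hj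
    have hsw : swap i j ∈ fixator V := swap_mem_fixator (Finset.disjoint_left.1 hSV hiS) hj.2.2
    rw [← hU _ (swap_mem_fixator hiU hj.2.1)]
    refine Submodule.mem_sup_right (smul_mem_of_mem_span ?_ (hW' W' subset_rfl))
    rintro _ ⟨σ, ⟨hσ, hσW⟩, x, hx, rfl⟩
    rw [← mul_smul]
    refine smul_mem_translates ⟨mul_mem hsw hσ, fun h => hj.1 (hσW ?_)⟩ hx
    rw [mul_smul, smul_eq_iff_eq_inv_smul] at h
    rw [h, Finset.mem_inv_smul_finset_iff, swap_smul_right]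
    exact hiS

/-- Noetherianity: a stable subspace of a bounded subspace is bounded. -/
theorem Bounded.of_le {d : ℕ} {V : Finset ℕ} {N R : Submodule (RatField k) M}
    (hN : Bounded V d N) (hR : Stable (fixator V) R) (h : R ≤ N) :
    ∃ V', V ⊆ V' ∧ Bounded V' d R := by
  induction d generalizing V N R with
  | zero =>
    obtain rfl : R = ⊥ := le_bot_iff.1 (bounded_zero hN ▸ h)
    exact ⟨V, subset_rfl, bounded_zero hN ▸ hN⟩
  | succ d ih =>
    obtain ⟨S, V₀, N₀, P, C, E, -, hV, hN₀, hN₀N, hP, hPR, hC, hCN, hle, hRE, hNE, hCE, -⟩ :=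
      hN.exists_decomposition hR
    have hR' := hR.mono (fixator_anti hV)
    obtain ⟨V₁, hV₁, hb⟩ := ih hN₀ (hR'.inf hN₀.stable) inf_le_right
    refine ⟨V₁, hV.trans hV₁, ?_⟩
    have hRe : R = P ⊔ R ⊓ N₀ := by
      refine le_antisymm (fun f hf => ?_) (sup_le hPR inf_le_left)
      obtain ⟨x, hx, c, hc, rfl⟩ := Submodule.mem_sup.1 (hle (h hf))
      obtain ⟨p, hp, n, hn, rfl⟩ := Submodule.mem_sup.1 hx
      -- The component `c` differs from `f ∈ R` by elements of `P ≤ R` and of `N₀`, so all its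
      -- translates are in `E`.
      have hc0 : c = 0 := hCE c hc fun τ hτ => by
        have h1 : c = (p + n + c) - p - n := by abel
        rw [h1, smul_sub, smul_sub]
        exact sub_mem (sub_mem (hRE (hR' τ hτ _ hf)) (hRE (hR' τ hτ _ (hPR hp))))
          (hNE (hN₀.stable τ hτ _ hn))
      subst hc0
      rw [add_zero] at hf ⊢
      exact Submodule.add_mem_sup hp ⟨(Submodule.add_mem_iff_right R (hPR hp)).1 hf, hn⟩
    rw [hRe]
    exact (hP.mono hV₁).sup (hb.mono_right d.le_succ)

/-- A linear map that is equivariant on a stable subspace `A` extends equivariantly to `A ⊔ N` after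
restriction to some `𝔖_{V'}`. -/
theorem Bounded.exists_extension {J : SmoothRep k} {d : ℕ} {V : Finset ℕ}
    {N A : Submodule (RatField k) M} (hN : Bounded V d N) (hA : Stable (fixator V) A)
    (f : M →ₗ[RatField k] J) (hf : ∀ σ ∈ fixator V, ∀ x ∈ A, f (σ • x) = σ • f x) :
    ∃ (V' : Finset ℕ) (g : M →ₗ[RatField k] J), V ⊆ V' ∧ (∀ x ∈ A, g x = f x) ∧
      ∀ σ ∈ fixator V', ∀ x ∈ A ⊔ N, g (σ • x) = σ • g x := by
  induction d generalizing V N A f with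
  | zero =>
    rw [bounded_zero hN, sup_bot_eq]
    exact ⟨V, f, subset_rfl, fun _ _ => rfl, hf⟩
  | succ d ih =>
    obtain ⟨S, V₀, N₀, P, C, E, -, hV, hN₀, hN₀N, hP, hPA, hC, hCN, hle, hAE, hNE, hCE, -⟩ :=
      hN.exists_decomposition hA
    have hA' := hA.mono (fixator_anti hV)
    obtain ⟨V₁, f', hV₁, hf'A, hf'⟩ := ih hN₀ hA' f fun σ hσ => hf σ (fixator_anti hV hσ)
    have hst := hA'.sup hN₀.stable
    -- Since `C` is stable and independent of `A ⊔ N₀`, the inductive extension to `A ⊔ N₀` can be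
    -- continued by zero on `C`.
    have hdis : Disjoint C (A ⊔ N₀) := Submodule.disjoint_def.2 fun c hc hcA =>
      hCE c hc fun τ hτ => sup_le hAE hNE (hst τ hτ c hcA)
    obtain ⟨D, hCD, hD⟩ := hdis.exists_isCompl
    obtain ⟨π, hπ, hπC⟩ : ∃ π : M →ₗ[RatField k] M, (∀ x ∈ A ⊔ N₀, π x = x) ∧
        ∀ c ∈ C, π c = 0 := by
      refine ⟨(A ⊔ N₀).subtype ∘ₗ Submodule.projectionOnto (A ⊔ N₀) D hD.symm,
        fun x hx => ?_, fun c hc => ?_⟩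
      · rw [LinearMap.comp_apply]
        exact congrArg Subtype.val (Submodule.projectionOnto_apply_left hD.symm ⟨x, hx⟩)
      · rw [LinearMap.comp_apply, Submodule.projectionOnto_apply_of_mem_right hD.symm (hCD hc),
          map_zero]
    refine ⟨V₁, f' ∘ₗ π, hV.trans hV₁, fun x hx => ?_, fun σ hσ x hx => ?_⟩
    · rw [LinearMap.comp_apply, hπ x (Submodule.mem_sup_left hx), hf'A x hx]
    · have hx' : x ∈ (A ⊔ N₀) ⊔ C := by
        refine sup_le (le_sup_of_le_left le_sup_left) (hle.trans ?_) hx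
        exact sup_le_sup_right (sup_le_sup_right hPA _) _
      obtain ⟨y, hy, c, hc, rfl⟩ := Submodule.mem_sup.1 hx'
      have hσ₀ := fixator_anti hV₁ hσ
      rw [LinearMap.comp_apply, LinearMap.comp_apply, smul_add, map_add π, map_add π, hπ y hy,
        hπ _ (hst σ hσ₀ y hy), hπC c hc, hπC _ (hC σ hσ₀ c hc), add_zero, add_zero, hf' σ hσ y hy]

end SmoothRep

/-! ### Erasing an index in 𝐈ʳ and enlarging the group of equivariance -/

namespace SmoothRep

open InfSymm

variable {k : Type u} [Field k]

theorem Subsets.coe_perm {r : ℕ} (σ : InfSymm) (S : Subsets r) :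
    (Subsets.perm σ S).1 = σ • S.1 := Finset.map_eq_image _ _

theorem Subsets.perm_inv_perm {r : ℕ} (σ : InfSymm) (S : Subsets r) :
    Subsets.perm σ (Subsets.perm σ⁻¹ S) = S := by
  rw [← Subsets.perm_mul, mul_inv_cancel, Subsets.perm_one]

theorem Subsets.perm_injective {r : ℕ} (σ : InfSymm) :
    Function.Injective (Subsets.perm (r := r) σ) := fun S T h => by
  have := congrArg (Subsets.perm σ⁻¹) h
  rwa [← Subsets.perm_mul, ← Subsets.perm_mul, inv_mul_cancel, Subsets.perm_one,
    Subsets.perm_one] at this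

theorem Subsets.smul_mem_perm {r : ℕ} {σ : InfSymm} {S : Subsets r} {i : ℕ} :
    σ • i ∈ (Subsets.perm σ S).1 ↔ i ∈ S.1 := by
  rw [Subsets.coe_perm, Finset.smul_mem_smul_finset_iff]

namespace StdSpace

variable {r : ℕ}

/-- The coefficient of `e_S`. -/
noncomputable def coeff (S : Subsets r) : StdSpace k r →ₗ[RatField k] RatField k :=
  Finsupp.lapply (M := RatField k) S

theorem coeff_single (S T : Subsets r) (a : RatField k) :
    coeff S (single T a) = if T = S then a else 0 := by
  classical
  exact Finsupp.single_apply

theorem ext_coeff {v w : StdSpace k r} (h : ∀ S, coeff S v = coeff S w) : v = w := Finsupp.ext h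

theorem coeff_perm_smul (σ : InfSymm) (S : Subsets r) (v : StdSpace k r) :
    coeff (Subsets.perm σ S) (σ • v) = σ • coeff S v := by
  induction v using StdSpace.induction with
  | zero => simp
  | add v w hv hw => rw [smul_add, map_add, map_add, smul_add, hv, hw]
  | hs T a =>
    rw [perm_smul_single, coeff_single, coeff_single]
    simp only [(Subsets.perm_injective σ).eq_iff]
    split_ifs <;> simp

theorem finite_support (v : StdSpace k r) : {S : Subsets r | coeff S v ≠ 0}.Finite :=
  Finsupp.hasFiniteSupport (M := RatField k) v

/-- The retraction onto the vectors that do not involve the index `i`. -/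
noncomputable def erase (i : ℕ) : StdSpace k r →+ StdSpace k r :=
  (Finsupp.filterAddHom (M := RatField k) fun S : Subsets r => i ∉ S.1).comp
    (Finsupp.mapRange.addMonoidHom (RatField.laurentCoeff k i 0))

theorem coeff_erase (i : ℕ) (S : Subsets r) (v : StdSpace k r) :
    coeff S (erase i v) = if i ∈ S.1 then 0 else RatField.laurentCoeff k i 0 (coeff S v) := by
  classical
  refine (Finsupp.filter_apply (M := RatField k) (fun S : Subsets r => i ∉ S.1) _ S).trans ?_
  by_cases h : i ∈ S.1
  · rw [if_pos h, if_neg (not_not.2 h)]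
  · rw [if_neg h, if_pos h]; rfl

theorem erase_smul {i : ℕ} {σ : InfSymm} (hσ : σ • i = i) (v : StdSpace k r) :
    erase i (σ • v) = σ • erase i v := by
  refine ext_coeff fun S => ?_
  obtain ⟨S, rfl⟩ : ∃ T, S = Subsets.perm σ T := ⟨_, (Subsets.perm_inv_perm σ S).symm⟩
  rw [coeff_perm_smul, coeff_erase, coeff_erase, coeff_perm_smul]
  have h : i ∈ (Subsets.perm σ S).1 ↔ i ∈ S.1 := by
    conv_lhs => rw [← hσ]
    exact Subsets.smul_mem_perm
  simp only [h]
  split_ifs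
  · rw [smul_zero]
  · rw [← RatField.laurentCoeff_smul, hσ]

theorem supp_coeff {U : Finset ℕ} {v : StdSpace k r} (h : Supp U v) (S : Subsets r) :
    Supp (U ∪ S.1) (coeff S v) := fun σ hσ => by
  rw [mem_fixator_union] at hσ
  have hS : Subsets.perm σ S = S := Subtype.ext (by
    rw [Subsets.coe_perm, smul_finset_eq_self hσ.2])
  rw [← coeff_perm_smul, hS, h σ hσ.1]

theorem supp_single {U : Finset ℕ} {a : RatField k} (h : Supp U a) (S : Subsets r) :
    Supp (U ∪ S.1) (single S a) := fun σ hσ => by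
  rw [mem_fixator_union] at hσ
  have hS : Subsets.perm σ S = S := Subtype.ext (by
    rw [Subsets.coe_perm, smul_finset_eq_self hσ.2])
  rw [perm_smul_single, hS, h σ hσ.1]

/-- If some `i` in `S` were outside `U`, swapping it with a fresh `j` would fix `v` and give a
nonzero coefficient at a set containing `j`, although `j` was chosen outside all sets that occur in
`v`. -/
theorem subset_of_supp {U : Finset ℕ} {v : StdSpace k r} (h : Supp U v) {S : Subsets r}
    (hS : coeff S v ≠ 0) : S.1 ⊆ U := by
  intro i hi
  by_contra hiU
  obtain ⟨j, hj⟩ := Infinite.exists_notMem_finset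
    (U ∪ (finite_support v).toFinset.biUnion fun T => T.1)
  rw [Finset.mem_union, not_or] at hj
  refine hj.2 (Finset.mem_biUnion.2 ⟨Subsets.perm (swap i j) S, ?_, ?_⟩)
  · rw [Set.Finite.mem_toFinset, Set.mem_ofPred_eq, ← h _ (swap_mem_fixator hiU hj.1),
      coeff_perm_smul]
    exact fun h0 => hS ((smul_eq_zero_iff_eq _).1 h0)
  · have := (Subsets.smul_mem_perm (σ := swap i j)).2 hi
    rwa [swap_smul_left] at this

theorem erase_eq_self {U : Finset ℕ} {v : StdSpace k r} (h : Supp U v) {i : ℕ} (hi : i ∉ U) :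
    erase i v = v := by
  refine ext_coeff fun S => ?_
  rw [coeff_erase]
  split_ifs with hS
  · by_contra h0
    exact hi (subset_of_supp h (Ne.symm h0) hS)
  · exact RatField.laurentCoeff_zero_eq (supp_coeff h S) (by simp [hi, hS])

theorem erase_smul_field {U : Finset ℕ} {a : RatField k} (h : Supp U a) {i : ℕ} (hi : i ∉ U)
    (v : StdSpace k r) : erase i (a • v) = a • erase i v := by
  refine ext_coeff fun S => ?_
  rw [LinearMap.map_smul, coeff_erase, coeff_erase, LinearMap.map_smul, smul_eq_mul, smul_eq_mul,
    RatField.laurentCoeff_mul h hi]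
  split_ifs <;> simp

theorem erase_single (i : ℕ) (S : Subsets r) (a : RatField k) :
    erase i (single S a) = if i ∈ S.1 then 0 else single S (RatField.laurentCoeff k i 0 a) := by
  classical
  refine ext_coeff fun T => ?_
  rw [coeff_erase]
  by_cases hS : i ∈ S.1
  · rw [if_pos hS, map_zero, coeff_single]
    split_ifs with h1 h2
    · rfl
    · exact (h1 (h2 ▸ hS)).elim
    · exact map_zero _
  · rw [if_neg hS, coeff_single, coeff_single]
    split_ifs with h1 h2
    · exact (hS (h2 ▸ h1)).elim
    · rfl
    · rfl
    · exact map_zero _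

theorem exists_supp_erase (i : ℕ) (v : StdSpace k r) :
    ∃ U : Finset ℕ, i ∉ U ∧ Supp U (erase i v) := by
  classical
  induction v using StdSpace.induction with
  | zero => exact ⟨∅, by simp, fun σ _ => by rw [map_zero, smul_zero]⟩
  | add v w hv hw =>
    obtain ⟨U, hU, h⟩ := hv
    obtain ⟨U', hU', h'⟩ := hw
    refine ⟨U ∪ U', by simp [hU, hU'], fun σ hσ => ?_⟩
    rw [mem_fixator_union] at hσ
    rw [map_add, smul_add, h σ hσ.1, h' σ hσ.2]
  | hs S a =>
    rw [erase_single]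
    split_ifs with hS
    · exact ⟨∅, by simp, fun σ _ => smul_zero _⟩
    · obtain ⟨U, hU, h⟩ := RatField.exists_supp_laurentCoeff i 0 a
      exact ⟨U ∪ S.1, by simp [hU, hS], supp_single h S⟩

end StdSpace

variable {M : SmoothRep k} {r : ℕ}

/-- A linear map to `𝐈ʳ` equivariant for `𝔖_{V ∪ i}` can be made equivariant for `𝔖_V`, without
changing it where it is equivariant for `𝔖`. -/
theorem exists_equivariant_of_insert {A : Submodule (RatField k) M} (hA : Stable ⊤ A)
    {V : Finset ℕ} {i : ℕ} (hi : i ∉ V) (g : M →ₗ[RatField k] std k r)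
    (hgA : ∀ σ : InfSymm, ∀ x ∈ A, g (σ • x) = σ • g x)
    (hg : ∀ σ ∈ fixator (insert i V), ∀ x, g (σ • x) = σ • g x) :
    ∃ g' : M →ₗ[RatField k] std k r, (∀ x ∈ A, g' x = g x) ∧
      ∀ σ ∈ fixator V, ∀ x, g' (σ • x) = σ • g' x := by
  classical
  let T : std k r →+ std k r := StdSpace.erase i
  have hT : ∀ {σ : InfSymm}, σ • i = i → ∀ v, T (σ • v) = σ • T v := fun hσ v =>
    StdSpace.erase_smul hσ v
  have hTg : ∀ σ ∈ fixator (insert i V), ∀ x, T (g (σ • x)) = σ • T (g x) := fun σ hσ x => by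
    rw [hg σ hσ, hT (mem_fixator.1 hσ i (by simp))]
  -- For `j` outside a support of `m`, the vector `swap i j • m` does not involve `i`. Any `i` in
  -- its image under `g` stems from the choice of `g`, and `T` erases it.
  let h : ℕ → M → std k r := fun j m => swap i j • T (g (swap i j • m))
  have hind : ∀ (U : Finset ℕ) (m : M) (j j' : ℕ), Supp U m → j ∉ insert i (U ∪ V) →
      j' ∉ insert i (U ∪ V) → h j m = h j' m := by
    intro U m j j' hU hj hj'
    simp only [Finset.mem_insert, Finset.mem_union, not_or] at hj hj'
    by_cases hjj : j = j'
    · rw [hjj]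
    have hρ : swap j j' ∈ fixator (insert i V) := swap_mem_fixator
      (by simp [hj.1, hj.2.2]) (by simp [hj'.1, hj'.2.2])
    have h1 : swap i j' • m = swap j j' • swap i j • m := by
      rw [← mul_smul]
      refine hU.smul_eq fun l hl => ?_
      have hlj : l ≠ j := fun h => hj.2.1 (h ▸ hl)
      have hlj' : l ≠ j' := fun h => hj'.2.1 (h ▸ hl)
      rw [mul_smul]
      by_cases hli : l = i
      · rw [hli, swap_smul_left, swap_smul_left, swap_smul_left]
      · rw [swap_smul_of_ne hli hlj', swap_smul_of_ne hli hlj, swap_smul_of_ne hlj hlj']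
    have h2 : Supp (swap i j • U ∪ insert i V) (T (g (swap i j • m))) := fun τ hτ => by
      rw [mem_fixator_union] at hτ
      rw [← hTg τ hτ.2, hU.smul _ τ hτ.1]
    obtain ⟨U', hU', hs⟩ := StdSpace.exists_supp_erase i (g (swap i j • m))
    -- Erasure provides a support avoiding `i`, which allows `i` to be dropped from the support in
    -- `h2`. On what remains, `swap i j` and `swap i j' * swap j j'` agree.
    have h3 := h2.erase hs hU'
    change swap i j • T (g (swap i j • m)) = swap i j' • T (g (swap i j' • m))
    rw [h1, hTg _ hρ, ← mul_smul]
    refine h3.smul_eq fun l hl => ?_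
    rw [Finset.mem_erase, Finset.mem_union, Finset.mem_insert] at hl
    have hlj' : l ≠ j' := by
      rintro rfl
      rcases hl.2 with hl' | hl' | hl'
      · obtain ⟨x, hx, hxl⟩ := Finset.mem_smul_finset.1 hl'
        have : x = l := MulAction.injective (swap i j) (hxl.trans
          (swap_smul_of_ne hl.1 (Ne.symm hjj)).symm)
        exact hj'.2.1 (this ▸ hx)
      · exact hl.1 hl'
      · exact hj'.2.2 hl'
    rw [mul_smul]
    by_cases hlj : l = j
    · rw [hlj, swap_smul_right, swap_smul_left, swap_smul_right]
    · rw [swap_smul_of_ne hl.1 hlj, swap_smul_of_ne hlj hlj', swap_smul_of_ne hl.1 hlj']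
  have hex : ∀ m : M, ∃ y, ∀ (U : Finset ℕ) (j : ℕ), Supp U m → j ∉ insert i (U ∪ V) →
      y = h j m := fun m => by
    obtain ⟨U₀, hU₀⟩ := exists_supp m
    obtain ⟨j₀, hj₀⟩ := Infinite.exists_notMem_finset (insert i (U₀ ∪ V))
    refine ⟨h j₀ m, fun U j hU hj => ?_⟩
    obtain ⟨l, hl⟩ := Infinite.exists_notMem_finset (insert i (U₀ ∪ V) ∪ insert i (U ∪ V))
    rw [Finset.mem_union, not_or] at hl
    rw [hind U₀ m j₀ l hU₀ hj₀ hl.1, hind U m l j hU hl.2 hj]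
  choose G hG using hex
  refine ⟨⟨⟨G, fun x y => ?_⟩, fun a x => ?_⟩, fun x hx => ?_, fun σ hσ x => ?_⟩
  · obtain ⟨U, hU⟩ := exists_supp x
    obtain ⟨U', hU'⟩ := exists_supp y
    obtain ⟨j, hj⟩ := Infinite.exists_notMem_finset (insert i ((U ∪ U') ∪ V))
    have hx := hU.mono (Finset.subset_union_left (s₂ := U'))
    have hy := hU'.mono (Finset.subset_union_right (s₁ := U))
    rw [hG _ _ j (supp_add hx hy) hj, hG _ _ j hx hj, hG _ _ j hy hj]
    change swap i j • T (g (swap i j • (x + y))) = _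
    rw [smul_add, map_add, map_add, smul_add]
  · obtain ⟨U, hU⟩ := exists_supp x
    obtain ⟨U', hU'⟩ := RatField.exists_supp a
    obtain ⟨j, hj⟩ := Infinite.exists_notMem_finset (insert i ((U ∪ U') ∪ V))
    have hx := hU.mono (Finset.subset_union_left (s₂ := U'))
    have ha := hU'.mono (Finset.subset_union_right (s₁ := U))
    change G (a • x) = a • G x
    rw [hG _ _ j (supp_smul ha hx) hj, hG _ _ j hx hj]
    change swap i j • T (g (swap i j • (a • x))) = a • swap i j • T (g (swap i j • x))
    -- The swapped scalar does not involve `i`, and `T` is linear over such scalars although not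
    -- over 𝐊.
    have hnot : i ∉ swap i j • (U ∪ U') := fun hmem => by
      obtain ⟨x, hx, hxi⟩ := Finset.mem_smul_finset.1 hmem
      have : x = j := MulAction.injective (swap i j) (hxi.trans (swap_smul_right i j).symm)
      exact hj (Finset.mem_insert_of_mem (Finset.mem_union_left _ (this ▸ hx)))
    have hTa : T ((swap i j • a) • g (swap i j • x)) = (swap i j • a) • T (g (swap i j • x)) :=
      StdSpace.erase_smul_field (ha.smul _) hnot _
    rw [M.semilinear, LinearMap.map_smul, hTa, (std k r).semilinear, ← mul_smul, swap_mul_self, one_smul]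
  · obtain ⟨U, hU⟩ := exists_supp x
    obtain ⟨j, hj⟩ := Infinite.exists_notMem_finset (insert i (U ∪ V))
    change G x = g x
    rw [hG x U j hU hj]
    change swap i j • T (g (swap i j • x)) = g x
    obtain ⟨W, hW⟩ := exists_supp (g x)
    have hnot : i ∉ swap i j • U := fun hmem => by
      obtain ⟨y, hy, hyi⟩ := Finset.mem_smul_finset.1 hmem
      have : y = j := MulAction.injective (swap i j) (hyi.trans (swap_smul_right i j).symm)
      exact hj (by rw [← this]; simp [hy])
    have hs : Supp (swap i j • U) (g (swap i j • x)) := fun τ hτ => by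
      rw [← hgA τ _ (hA _ trivial x hx), hU.smul _ τ hτ]
    have hTx : T (g (swap i j • x)) = g (swap i j • x) := StdSpace.erase_eq_self hs hnot
    rw [hTx, hgA _ x hx, ← mul_smul, swap_mul_self, one_smul]
  · obtain ⟨U, hU⟩ := exists_supp x
    obtain ⟨n, hn⟩ := σ.2
    -- Taking `j` beyond the indices moved by `σ` gives `σ • j = j`; conjugating `σ` by the swap of
    -- `i` and `j` then yields an element that fixes `i` as well as `V`.
    obtain ⟨j, hj⟩ := Infinite.exists_notMem_finset
      (insert i ((U ∪ V) ∪ (σ • U ∪ V)) ∪ Finset.range n)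
    simp only [Finset.mem_union, Finset.mem_insert, Finset.mem_range, not_or, not_lt] at hj
    have hσj : σ • j = j := hn j hj.2
    change G (σ • x) = σ • G x
    rw [hG _ (σ • U) j (hU.smul σ) (by simp only [Finset.mem_union, Finset.mem_insert]; tauto),
      hG _ U j hU (by simp only [Finset.mem_union, Finset.mem_insert]; tauto)]
    change swap i j • T (g (swap i j • σ • x)) = σ • swap i j • T (g (swap i j • x))
    have hτ : swap i j * σ * swap i j ∈ fixator (insert i V) := mem_fixator.2 fun l hl => by
      rw [mul_smul, mul_smul]
      rcases Finset.mem_insert.1 hl with rfl | hl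
      · rw [swap_smul_left, hσj, swap_smul_right]
      · have hlij : swap i j • l = l := swap_smul_of_ne (fun h => hi (h ▸ hl))
          (fun h => hj.1.2.1.2 (h ▸ hl))
        rw [hlij, mem_fixator.1 hσ l hl, hlij]
    have hmul : swap i j • σ • x = (swap i j * σ * swap i j) • swap i j • x := by
      rw [← mul_smul, ← mul_smul, mul_assoc _ (swap i j), swap_mul_self, mul_one]
    rw [hmul, hTg _ hτ, ← mul_smul, ← mul_smul, ← mul_assoc, ← mul_assoc, swap_mul_self, one_mul]

theorem exists_equivariant {A : Submodule (RatField k) M} (hA : Stable ⊤ A) (V : Finset ℕ)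
    (g : M →ₗ[RatField k] std k r) (hgA : ∀ σ : InfSymm, ∀ x ∈ A, g (σ • x) = σ • g x)
    (hg : ∀ σ ∈ fixator V, ∀ x, g (σ • x) = σ • g x) :
    ∃ g' : M ⟶ std k r, ∀ x ∈ A, g'.hom x = g x := by
  classical
  induction V using Finset.induction generalizing g with
  | empty => exact ⟨⟨g, fun σ x => hg σ (mem_fixator.2 (by simp)) x⟩, fun _ _ => rfl⟩
  | insert i V hi ih =>
    obtain ⟨g₁, h₁, h₂⟩ := exists_equivariant_of_insert hA hi g hgA hg
    obtain ⟨g', hg'⟩ := ih g₁ (fun σ x hx => by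
      rw [h₁ x hx, h₁ _ (hA σ trivial x hx), hgA σ x hx]) h₂
    exact ⟨g', fun x hx => (hg' x hx).trans (h₁ x hx)⟩

/-- The extension over a small group comes from the decomposition, and the special form of the
target restores equivariance for all of 𝔖. -/
theorem exists_extension {A N : Submodule (RatField k) M} (hA : Stable ⊤ A) {V : Finset ℕ} {d : ℕ}
    (hN : Bounded V d N) (hAN : A ⊔ N = ⊤) (f : M →ₗ[RatField k] std k r)
    (hf : ∀ σ : InfSymm, ∀ x ∈ A, f (σ • x) = σ • f x) :
    ∃ g : M ⟶ std k r, ∀ x ∈ A, g.hom x = f x := by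
  obtain ⟨V', g, -, hgA, hg⟩ := hN.exists_extension (hA.mono le_top) f fun σ _ => hf σ
  rw [hAN] at hg
  obtain ⟨g', hg'⟩ := exists_equivariant hA V' g (fun σ x hx => by
    rw [hgA x hx, hgA _ (hA σ trivial x hx), hf σ x hx]) fun σ hσ x => hg σ hσ x trivial
  exact ⟨g', fun x hx => (hg' x hx).trans (hgA x hx)⟩

end SmoothRep

/-! ### Injectivity of 𝐈ʳ -/

namespace SmoothRep

open InfSymm

variable {k : Type u} [Field k] {r : ℕ}

/-- An equivariant map to `𝐈ʳ` extends to the subspace generated by one more vector. -/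
theorem exists_extension_adjoin {E : SmoothRep k} {R : Submodule (RatField k) E}
    (hR : Stable ⊤ R) (p : E →ₗ[RatField k] std k r)
    (hp : ∀ σ : InfSymm, ∀ y ∈ R, p (σ • y) = σ • p y) (x : E) :
    ∃ (B : Submodule (RatField k) E) (hB : Stable ⊤ B),
      R ≤ B ∧ x ∈ B ∧ ∃ g : E.sub B (fun σ v hv => hB σ trivial v hv) ⟶ std k r,
        ∀ y : B, (y : E) ∈ R → g.hom y = p y := by
  let N : Submodule (RatField k) E :=
    Submodule.span (RatField k) (translates ((⊤ : Subgroup InfSymm) : Set InfSymm) {x})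
  have hN : Stable ⊤ N := stable_span_translates fun σ _ τ _ => trivial
  have hB : Stable ⊤ (R ⊔ N) := hR.sup hN
  have hxN : x ∈ N := span_le_span_translates (Submodule.subset_span rfl)
  let F : SmoothRep k := E.sub (R ⊔ N) (fun σ v hv => hB σ trivial v hv)
  let A' : Submodule (RatField k) F := R.comap (R ⊔ N).subtype
  let x' : F := (⟨x, Submodule.mem_sup_right hxN⟩ : ↥(R ⊔ N))
  obtain ⟨V, hV⟩ := exists_supp x'
  let N' : Submodule (RatField k) F :=
    Submodule.span (RatField k) (translates (fixator ∅ : Set InfSymm) {x'})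
  have hN' : Bounded ∅ (V.card + 1) N' := by
    refine ⟨{x'}, Set.finite_singleton _, ?_, rfl⟩
    rintro _ rfl
    exact ⟨V, by omega, hV.mono (by simp)⟩
  have hA' : Stable ⊤ A' := fun σ hσ y hy => hR σ hσ y.1 hy
  have hle : N ≤ Submodule.map (R ⊔ N).subtype N' := Submodule.span_le.2 (by
    rintro _ ⟨σ, -, _, rfl, rfl⟩
    exact ⟨σ • x', smul_mem_translates (mem_fixator.2 (by simp)) rfl, rfl⟩)
  have htop : A' ⊔ N' = ⊤ := by
    refine eq_top_iff.2 fun y _ => ?_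
    obtain ⟨a, ha, n, hn, hy⟩ := Submodule.mem_sup.1 y.2
    obtain ⟨n', hn', rfl⟩ := hle hn
    refine Submodule.mem_sup.2 ⟨(⟨a, Submodule.mem_sup_left ha⟩ : ↥(R ⊔ N)), ha, n', hn', ?_⟩
    exact Subtype.ext hy
  obtain ⟨g, hg⟩ := exists_extension hA' hN' htop (p ∘ₗ (R ⊔ N).subtype) fun σ y hy =>
    hp σ y.1 hy
  exact ⟨R ⊔ N, hB, le_sup_left, Submodule.mem_sup_right hxN, g, fun y hy => hg y hy⟩

/-- Every monomorphism out of `𝐈ʳ` splits. -/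
theorem exists_retraction {E : SmoothRep k} (j : std k r ⟶ E) (hj : Function.Injective j.hom) :
    ∃ ρ : E ⟶ std k r, j ≫ ρ = 𝟙 _ := by
  let I : Submodule (RatField k) E := LinearMap.range j.hom
  have hI : Stable ⊤ I := fun σ _ v hv => range_stable j σ v hv
  -- A maximal stable `Γ` disjoint from the image `I` will be a complement; only finitely generated
  -- enlargements of `Γ ⊔ I` are needed to see this.
  obtain ⟨Γ, hΓ⟩ := zorn_le₀ {Γ : Submodule (RatField k) E | Stable ⊤ Γ ∧ Disjoint Γ I} (by
    intro c hc hchain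
    rcases c.eq_empty_or_nonempty with rfl | hne
    · refine ⟨⊥, ⟨fun σ _ x hx => ?_, disjoint_bot_left⟩, by simp⟩
      rw [Submodule.mem_bot] at hx ⊢
      rw [hx, smul_zero]
    · have hmem : ∀ x, x ∈ sSup c ↔ ∃ Γ ∈ c, x ∈ Γ := fun x =>
        Submodule.mem_sSup_of_directed hne hchain.directedOn
      refine ⟨sSup c, ⟨fun σ hσ x hx => ?_, Submodule.disjoint_def.2 fun x hx hxI => ?_⟩,
        fun _ => le_sSup⟩
      · obtain ⟨Γ, hΓ, hx⟩ := (hmem x).1 hx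
        exact (hmem _).2 ⟨Γ, hΓ, (hc hΓ).1 σ hσ x hx⟩
      · obtain ⟨Γ, hΓ, hx⟩ := (hmem x).1 hx
        exact Submodule.disjoint_def.1 (hc hΓ).2 x hx hxI)
  obtain ⟨hΓst, hΓI⟩ := hΓ.prop
  -- A linear map that vanishes on `Γ` and inverts `j` on `I`; it is equivariant on `Γ ⊔ I`, though
  -- perhaps not elsewhere.
  obtain ⟨l, hl⟩ := LinearMap.exists_leftInverse_of_injective (Γ.mkQ ∘ₗ j.hom) (by
    rw [LinearMap.ker_eq_bot']
    intro y hy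
    rw [LinearMap.comp_apply, ← LinearMap.mem_ker, Submodule.ker_mkQ] at hy
    exact hj (by rw [map_zero]; exact Submodule.disjoint_def.1 hΓI _ hy ⟨y, rfl⟩))
  let p : E →ₗ[RatField k] std k r := l ∘ₗ Γ.mkQ
  have hpj : ∀ y, p (j.hom y) = y := fun y => LinearMap.congr_fun hl y
  have hpΓ : ∀ y ∈ Γ, p y = 0 := fun y hy => by
    rw [LinearMap.comp_apply, (LinearMap.mem_ker (f := Γ.mkQ)).1 (by rwa [Submodule.ker_mkQ]),
      map_zero]
  have hpR : ∀ σ : InfSymm, ∀ y ∈ Γ ⊔ I, p (σ • y) = σ • p y := by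
    intro σ y hy
    obtain ⟨a, ha, _, ⟨b, rfl⟩, rfl⟩ := Submodule.mem_sup.1 hy
    rw [smul_add, map_add, map_add, ← SmoothRep.map_smul j, hpj, hpj, hpΓ a ha,
      hpΓ _ (hΓst σ trivial a ha), zero_add, zero_add]
  have htop : ∀ x : E, x ∈ Γ ⊔ I := by
    intro x
    obtain ⟨B, hB, hRB, hxB, g, hg⟩ := exists_extension_adjoin (hΓst.sup hI) p hpR x
    -- The kernel of the extended retraction contains `Γ` and is still disjoint from `I`, so it
    -- equals `Γ` by maximality; it contains `x` minus the retraction of `x`.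
    let Γ' : Submodule (RatField k) E := Submodule.map B.subtype (LinearMap.ker g.hom)
    have hle : Γ ≤ Γ' := fun y hy => by
      have hyR : y ∈ Γ ⊔ I := Submodule.mem_sup_left hy
      refine ⟨⟨y, hRB hyR⟩, ?_, rfl⟩
      exact (hg ⟨y, hRB hyR⟩ hyR).trans (hpΓ y hy)
    have hΓ' : Γ' ≤ Γ := by
      refine hΓ.le_of_ge ⟨?_, Submodule.disjoint_def.2 ?_⟩ hle
      · rintro σ - _ ⟨y, hy, rfl⟩
        exact ⟨_, ker_stable g σ y hy, rfl⟩
      · rintro _ ⟨y, hy, rfl⟩ ⟨z, hz⟩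
        have h1 : g.hom y = z := by
          rw [hg y (Submodule.mem_sup_right ⟨z, hz⟩), ← hpj z, hz]; rfl
        have h2 : z = 0 := h1.symm.trans hy
        rw [← hz, h2, map_zero]
    have hjB : j.hom (g.hom (⟨x, hxB⟩ : B)) ∈ Γ ⊔ I := Submodule.mem_sup_right ⟨_, rfl⟩
    have h1 : x - j.hom (g.hom (⟨x, hxB⟩ : B)) ∈ Γ' := by
      refine ⟨(⟨x, hxB⟩ : B) - ⟨_, hRB hjB⟩, ?_, rfl⟩
      refine (LinearMap.mem_ker (f := g.hom)).2 ((map_sub g.hom _ _).trans (sub_eq_zero.2 ?_))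
      exact ((hg ⟨_, hRB hjB⟩ hjB).trans (hpj _)).symm
    rw [← sub_add_cancel x (j.hom (g.hom (⟨x, hxB⟩ : B)))]
    exact Submodule.add_mem_sup (hΓ' h1) ⟨_, rfl⟩
  exact ⟨⟨p, fun σ v => hpR σ v (htop v)⟩, hom_ext fun v => hpj v⟩

/-- To extend `f` along `i`, push `i` out along `f` and retract the resulting monomorphism out of
𝐈ʳ. -/
instance injective_std (k : Type u) [Field k] (r : ℕ) : Injective (std k r) where
  factors {X Y} f i _ := by
    obtain ⟨ρ, hρ⟩ := exists_retraction (pushout.inl f i) (injective_of_mono _)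
    refine ⟨pushout.inr f i ≫ ρ, ?_⟩
    rw [← Category.assoc, ← pushout.condition, Category.assoc, hρ, Category.comp_id]

end SmoothRep

/-! ### Invariants of semilinear representations of a stabilizer -/

namespace InfSymm

variable {k : Type u} [Field k]

section Descent

variable {S : Finset ℕ} {W : Type*} [AddCommGroup W] [Module (RatField k) W]
  [DistribMulAction (MulAction.stabilizer InfSymm S) W]

/-- `w` is fixed by the elements of the stabilizer of `S` that fix `V` pointwise. -/
def StabSupp (V : Finset ℕ) (w : W) : Prop :=
  ∀ h : MulAction.stabilizer InfSymm S, (h : InfSymm) ∈ fixator V → h • w = w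

theorem mem_stabilizer_of_mem_fixator {V : Finset ℕ} (h : S ⊆ V) {σ : InfSymm}
    (hσ : σ ∈ fixator V) : σ ∈ MulAction.stabilizer InfSymm S :=
  MulAction.mem_stabilizer_iff.2 (smul_finset_eq_self (fixator_anti h hσ))

theorem StabSupp.mono {V V' : Finset ℕ} {w : W} (h : StabSupp (S := S) V w) (hV : V ⊆ V') :
    StabSupp (S := S) V' w := fun g hg => h g (fixator_anti hV hg)

theorem StabSupp.smul {V : Finset ℕ} {w : W} (h : StabSupp (S := S) V w)
    (g : MulAction.stabilizer InfSymm S) : StabSupp (S := S) ((g : InfSymm) • V) (g • w) := by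
  intro τ hτ
  rw [← mul_smul, ← inv_smul_eq_iff, ← mul_smul]
  refine h _ (mem_fixator.2 fun i hi => ?_)
  change ((g : InfSymm)⁻¹ * ((τ : InfSymm) * (g : InfSymm))) • i = i
  rw [mul_smul, mul_smul, mem_fixator.1 hτ _ (Finset.smul_mem_smul_finset hi), inv_smul_smul]

theorem StabSupp.erase {U V : Finset ℕ} {w : W} {i : ℕ} (h : StabSupp (S := S) V w)
    (hU : StabSupp (S := S) U w) (hi : i ∉ U) (hiS : i ∉ S) (hSV : S ⊆ V) :
    StabSupp (S := S) (V.erase i) w := by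
  intro σ hσ
  obtain ⟨α, hα, β, hβ, ρ, hρ, hαβρ⟩ := exists_factorization (U := U ∪ S) (by simp [hi, hiS]) hσ
  have e : σ = (⟨α, mem_stabilizer_of_mem_fixator hSV hα⟩ : MulAction.stabilizer InfSymm S) *
      ⟨β, mem_stabilizer_of_mem_fixator Finset.subset_union_right hβ⟩ *
      ⟨ρ, mem_stabilizer_of_mem_fixator hSV hρ⟩ := Subtype.ext hαβρ
  rw [e, mul_smul, mul_smul, h ⟨ρ, _⟩ hρ, hU ⟨β, _⟩ (fixator_anti Finset.subset_union_left hβ),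
    h ⟨α, _⟩ hα]

variable (hs : ∀ (h : MulAction.stabilizer InfSymm S) (a : RatField k) (w : W),
  h • (a • w) = ((h : InfSymm) • a) • (h • w))
include hs

/-- One index outside `S` can be removed from the support of a spanning set. -/
theorem span_stabSupp_erase {V : Finset ℕ} (hSV : S ⊆ V) {i : ℕ} (hiV : i ∈ V) (hiS : i ∉ S)
    (hV : Submodule.span (RatField k) {w : W | StabSupp (S := S) V w} = ⊤) :
    Submodule.span (RatField k) {w : W | StabSupp (S := S) (V.erase i) w} = ⊤ := by
  classical
  obtain ⟨j, hj⟩ := Infinite.exists_notMem_finset V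
  have hjS : j ∉ S := fun h => hj (hSV h)
  have hij : i ≠ j := fun h => hj (h ▸ hiV)
  let s : MulAction.stabilizer InfSymm S := ⟨swap i j, MulAction.mem_stabilizer_iff.2
    (smul_finset_eq_self (swap_mem_fixator hiS hjS))⟩
  have hss : ∀ w : W, s • s • w = w := fun w => by
    rw [← mul_smul, show s * s = 1 from Subtype.ext (swap_mul_self i j), one_smul]
  let V' : Finset ℕ := swap i j • V
  have hiV' : i ∉ V' := fun h => by
    obtain ⟨x, hx, hxi⟩ := Finset.mem_smul_finset.1 h
    have : x = j := MulAction.injective (swap i j) (hxi.trans (swap_smul_right i j).symm)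
    exact hj (this ▸ hx)
  -- The swap `s` transports the spanning hypothesis from `V` to `V'`, which avoids `i`. This gives
  -- a basis not involving `i`, in which coordinates can be expanded in `ξ_i`.
  have hV' : ⊤ ≤ Submodule.span (RatField k) {w : W | StabSupp (S := S) V' w} := by
    have key : ∀ w ∈ Submodule.span (RatField k) {w : W | StabSupp (S := S) V w},
        s • w ∈ Submodule.span (RatField k) {w : W | StabSupp (S := S) V' w} := by
      intro w hw
      induction hw using Submodule.span_induction with
      | mem y hy => exact Submodule.subset_span (StabSupp.smul hy s)
      | zero => rw [smul_zero]; exact Submodule.zero_mem _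
      | add y z _ _ hy hz => rw [smul_add]; exact Submodule.add_mem _ hy hz
      | smul a y _ hy => rw [hs]; exact Submodule.smul_mem _ _ hy
    intro w _
    have := key (s • w) (by rw [hV]; trivial)
    rwa [hss] at this
  let B := Module.Basis.ofSpan hV'
  have hB : ∀ b, StabSupp (S := S) V' (B b) := fun b =>
    Module.Basis.ofSpan_subset hV' ⟨b, rfl⟩
  let lc := Finsupp.linearCombination (RatField k) B
  have hlc : ∀ w, lc (B.repr w) = w := B.linearCombination_repr
  have hlc_smul : ∀ g : MulAction.stabilizer InfSymm S, (g : InfSymm) ∈ fixator V' →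
      ∀ f, g • lc f = lc (Finsupp.mapRange ((g : InfSymm) • ·) (smul_zero _) f) := by
    intro g hg f
    induction f using Finsupp.induction_linear with
    | zero => simp
    | add f₁ f₂ h₁ h₂ =>
      rw [map_add, smul_add, h₁, h₂, Finsupp.mapRange_add (fun x y => smul_add _ x y), map_add]
    | single b a =>
      rw [Finsupp.mapRange_single, Finsupp.linearCombination_single,
        Finsupp.linearCombination_single, hs, hB b g hg]
  have hrepr : ∀ {U : Finset ℕ} {y : W}, StabSupp (S := S) U y → i ∉ U → ∀ b,
      Supp (V' ∪ (U ∪ S)) (B.repr y b) := by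
    intro U y hy hiU b σ hσ
    rw [mem_fixator_union, mem_fixator_union] at hσ
    let g : MulAction.stabilizer InfSymm S := ⟨σ, mem_stabilizer_of_mem_fixator subset_rfl hσ.2.2⟩
    have h1 := hlc_smul g hσ.1 (B.repr y)
    rw [hlc, hy g hσ.2.1] at h1
    have h2 := congrArg (fun w => B.repr w b) h1
    simp only [lc, Module.Basis.repr_linearCombination, Finsupp.mapRange_apply] at h2
    exact h2.symm
  -- The `n`-th Laurent coefficient in `ξ_i`, taken in coordinates. By `hTsmul` it does not depend
  -- on the chosen basis of vectors not involving `i`, which is why it commutes with the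
  -- permutations fixing `V`.
  let T : ℤ → W → W := fun n w =>
    lc (Finsupp.mapRange.addMonoidHom (RatField.laurentCoeff k i n) (B.repr w))
  have hTadd : ∀ n w w', T n (w + w') = T n w + T n w' := fun n w w' => by
    simp only [T, map_add]
  have hTsmul : ∀ n {U : Finset ℕ} {y : W}, StabSupp (S := S) U y → i ∉ U → ∀ a : RatField k,
      T n (a • y) = RatField.laurentCoeff k i n a • y := by
    intro n U y hy hiU a
    apply B.repr.injective
    ext b
    simp only [T, lc, Module.Basis.repr_linearCombination, Finsupp.mapRange.addMonoidHom_apply,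
      Finsupp.mapRange_apply, LinearEquiv.map_smul, Finsupp.smul_apply, smul_eq_mul]
    rw [mul_comm, RatField.laurentCoeff_mul (hrepr hy hiU b) (by simp [hiV', hiU, hiS]), mul_comm]
  have hTcomm : ∀ n (τ : MulAction.stabilizer InfSymm S), (τ : InfSymm) ∈ fixator V →
      ∀ w, T n (τ • w) = τ • T n w := by
    intro n τ hτ w
    have hτi : (τ : InfSymm) • i = i := mem_fixator.1 hτ i hiV
    rw [← hlc w]
    induction B.repr w using Finsupp.induction_linear with
    | zero => simp [T]
    | add f₁ f₂ h₁ h₂ => rw [map_add, smul_add, hTadd, h₁, h₂, hTadd, smul_add]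
    | single b a =>
      rw [Finsupp.linearCombination_single, hs, hTsmul n (hB b) hiV', hs,
        hTsmul n ((hB b).smul τ), ← RatField.laurentCoeff_smul, hτi]
      intro h
      obtain ⟨x, hx, hxi⟩ := Finset.mem_smul_finset.1 h
      exact hiV' (MulAction.injective (τ : InfSymm) (hxi.trans hτi.symm) ▸ hx)
  have hTsupp : ∀ n w, ∃ U : Finset ℕ, i ∉ U ∧ StabSupp (S := S) U (T n w) := by
    intro n w
    rw [← hlc w]
    induction B.repr w using Finsupp.induction_linear with
    | zero => exact ⟨∅, by simp, fun g _ => by simp [T]⟩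
    | add f₁ f₂ h₁ h₂ =>
      obtain ⟨U₁, hi₁, h₁⟩ := h₁
      obtain ⟨U₂, hi₂, h₂⟩ := h₂
      refine ⟨U₁ ∪ U₂, by simp [hi₁, hi₂], fun g hg => ?_⟩
      rw [mem_fixator_union] at hg
      rw [map_add, hTadd, smul_add, h₁ g hg.1, h₂ g hg.2]
    | single b a =>
      obtain ⟨U, hiU, hU⟩ := RatField.exists_supp_laurentCoeff i n a
      refine ⟨U ∪ V', by simp [hiU, hiV'], fun g hg => ?_⟩
      rw [mem_fixator_union] at hg
      rw [Finsupp.linearCombination_single, hTsmul n (hB b) hiV', hs, hU _ hg.1, hB b g hg.2]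
  have hTmem : ∀ n w, StabSupp (S := S) V w → StabSupp (S := S) (V.erase i) (T n w) := by
    intro n w hw
    obtain ⟨U, hiU, hU⟩ := hTsupp n w
    refine StabSupp.erase (fun τ hτ => ?_) hU hiU hiS hSV
    rw [← hTcomm n τ hτ, hw τ hτ]
  by_contra hne
  obtain ⟨l, hl0, hl⟩ := Submodule.exists_le_ker_of_lt_top _ (lt_top_iff_ne_top.2 hne)
  -- The generating series of the values of `l` on the coefficients `T n`. It is linear along
  -- `toLaurent`, so its vanishing on a spanning set forces it to vanish everywhere.
  let Λ : (_ →₀ RatField k) →+ LaurentSeries (RatField k) := Finsupp.liftAddHom fun b =>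
    (AddMonoidHom.mulRight (HahnSeries.C (l (B b)))).comp
      (RatField.toLaurent k i : RatField k →+ LaurentSeries (RatField k))
  have hΛsingle : ∀ b a, Λ (Finsupp.single b a) =
      RatField.toLaurent k i a * HahnSeries.C (l (B b)) := fun b a =>
    Finsupp.liftAddHom_apply_single _ b a
  have hΛcoeff : ∀ n f, (Λ f).coeff n =
      l (lc (Finsupp.mapRange.addMonoidHom (RatField.laurentCoeff k i n) f)) := by
    intro n f
    induction f using Finsupp.induction_linear with
    | zero => simp
    | add f₁ f₂ h₁ h₂ => simp only [map_add, HahnSeries.coeff_add, h₁, h₂]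
    | single b a =>
      rw [hΛsingle, HahnSeries.C_apply, HahnSeries.coeff_mul_single_zero,
        Finsupp.mapRange.addMonoidHom_apply, Finsupp.mapRange_single,
        Finsupp.linearCombination_single, LinearMap.map_smul]
      rfl
  have hΛsmul : ∀ a f, Λ (a • f) = RatField.toLaurent k i a * Λ f := by
    intro a f
    induction f using Finsupp.induction_linear with
    | zero => simp
    | add f₁ f₂ h₁ h₂ => rw [smul_add, map_add, map_add, h₁, h₂, mul_add]
    | single b c => rw [Finsupp.smul_single, hΛsingle, hΛsingle, smul_eq_mul, map_mul, mul_assoc]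
  have hΛ0 : ∀ w ∈ Submodule.span (RatField k) {w : W | StabSupp (S := S) V w},
      Λ (B.repr w) = 0 := by
    intro w hw
    induction hw using Submodule.span_induction with
    | mem y hy =>
      ext n
      rw [hΛcoeff, HahnSeries.coeff_zero]
      exact hl (Submodule.subset_span (hTmem n y hy))
    | zero => simp
    | add y z _ _ hy hz => rw [map_add, map_add, hy, hz, add_zero]
    | smul a y _ hy => rw [LinearEquiv.map_smul, hΛsmul, hy, mul_zero]
  -- On a basis vector the series is the constant `l (B b)`, hence `l = 0`.
  refine hl0 (B.ext fun b => ?_)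
  have := hΛ0 (B b) (by rw [hV]; trivial)
  rw [B.repr_self, hΛsingle, map_one, one_mul] at this
  exact HahnSeries.C_injective (this.trans (map_zero _).symm)

/-- A semilinear representation of the stabilizer of `S` that is spanned by the vectors with a
given finite support is spanned by its invariants. -/
theorem span_stabilizer_invariants {V : Finset ℕ}
    (hV : Submodule.span (RatField k) {w : W | StabSupp (S := S) V w} = ⊤) :
    Submodule.span (RatField k)
      {w : W | ∀ h : MulAction.stabilizer InfSymm S, h • w = w} = ⊤ := by
  classical
  have key : ∀ D : Finset ℕ,
      Submodule.span (RatField k) {w : W | StabSupp (S := S) (S ∪ D) w} = ⊤ →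
      Submodule.span (RatField k) {w : W | StabSupp (S := S) S w} = ⊤ := by
    intro D
    induction D using Finset.induction with
    | empty => rw [Finset.union_empty]; exact id
    | insert i D hi ih =>
      intro h
      by_cases hiS : i ∈ S
      · refine ih ?_
        rwa [Finset.union_insert, Finset.insert_eq_of_mem (Finset.mem_union_left _ hiS)] at h
      · refine ih ?_
        have := span_stabSupp_erase hs Finset.subset_union_left (by simp) hiS h
        rwa [Finset.union_insert, Finset.erase_insert (by simp [hi, hiS])] at this
  -- Once only the indices of `S` remain in the supports, Galois descent applies to the permutations
  -- of `S`.
  have hS := key V (top_le_iff.1 (hV ▸ Submodule.span_mono fun w hw =>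
    StabSupp.mono hw Finset.subset_union_right))
  refine top_le_iff.1 (hS ▸ Submodule.span_le.2 fun w hw => ?_)
  refine Submodule.span_mono (fun y hy h => hy.2 h (mem_fixator.2 (by simp)))
    (mem_span_invariants hs (Finset.disjoint_empty_right S) (N := ⊤) (fun _ _ _ _ => trivial)
      trivial fun h hh => hw h ?_)
  rwa [Finset.empty_union] at hh

end Descent

end InfSymm

/-! ### The top degree quotient and its functionals -/

namespace SmoothRep

open InfSymm

variable {k : Type u} [Field k] {M N : SmoothRep k}

/-- The subspace spanned by the vectors that have a support not containing `S`. -/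
noncomputable def offSpan (M : SmoothRep k) (S : Finset ℕ) : Submodule (RatField k) M :=
  Submodule.span (RatField k) {x | ∃ U : Finset ℕ, ¬S ⊆ U ∧ Supp U x}

theorem mem_offSpan {S U : Finset ℕ} {x : M} (hS : ¬S ⊆ U) (hx : Supp U x) : x ∈ offSpan M S :=
  Submodule.subset_span ⟨U, hS, hx⟩

theorem smul_mem_offSpan {S : Finset ℕ} {x : M} (σ : InfSymm) (hx : x ∈ offSpan M S) :
    σ • x ∈ offSpan M (σ • S) :=
  smul_mem_of_mem_span (by
    rintro y ⟨U, hU, hy⟩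
    exact mem_offSpan (fun h => hU (Finset.smul_finset_subset_smul_finset_iff.1 h)) (hy.smul σ)) hx

theorem map_mem_offSpan (f : M ⟶ N) {S : Finset ℕ} {x : M} (hx : x ∈ offSpan M S) :
    f.hom x ∈ offSpan N S := by
  induction hx using Submodule.span_induction with
  | mem y hy =>
    obtain ⟨U, hU, hy⟩ := hy
    exact mem_offSpan hU fun σ hσ => by rw [← SmoothRep.map_smul, hy σ hσ]
  | zero => rw [map_zero]; exact Submodule.zero_mem _
  | add y z _ _ hy hz => rw [map_add]; exact Submodule.add_mem _ hy hz
  | smul a y _ hy => rw [LinearMap.map_smul]; exact Submodule.smul_mem _ _ hy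

theorem smul_mem_offSpan_of_mem_stabilizer {S : Finset ℕ} {σ : InfSymm}
    (hσ : σ ∈ MulAction.stabilizer InfSymm S) {x : M} (hx : x ∈ offSpan M S) :
    σ • x ∈ offSpan M S := by
  have := smul_mem_offSpan σ hx
  rwa [MulAction.mem_stabilizer_iff.1 hσ] at this

/-- The quotient by `offSpan M S`. (A type of its own, to carry the action of the stabilizer
of `S`.) -/
def OffQuotient (M : SmoothRep k) (S : Finset ℕ) : Type u := M ⧸ offSpan M S

namespace OffQuotient

variable {S : Finset ℕ}

noncomputable instance : AddCommGroup (OffQuotient M S) :=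
  inferInstanceAs (AddCommGroup (M ⧸ offSpan M S))

noncomputable instance : Module (RatField k) (OffQuotient M S) :=
  inferInstanceAs (Module (RatField k) (M ⧸ offSpan M S))

/-- The projection. -/
noncomputable def mk (M : SmoothRep k) (S : Finset ℕ) : M →ₗ[RatField k] OffQuotient M S :=
  (offSpan M S).mkQ

theorem mk_surjective : Function.Surjective (mk M S) := Submodule.mkQ_surjective _

theorem mk_eq_zero {x : M} : mk M S x = 0 ↔ x ∈ offSpan M S := Submodule.Quotient.mk_eq_zero _

/-- The action of an element of the stabilizer of `S`. -/
noncomputable def act (σ : MulAction.stabilizer InfSymm S) :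
    OffQuotient M S →+ OffQuotient M S :=
  QuotientAddGroup.map (offSpan M S).toAddSubgroup (offSpan M S).toAddSubgroup
    (DistribSMul.toAddMonoidHom M (σ : InfSymm))
    (fun _ hx => smul_mem_offSpan_of_mem_stabilizer σ.2 hx)

noncomputable instance : DistribMulAction (MulAction.stabilizer InfSymm S) (OffQuotient M S) where
  smul σ := act σ
  one_smul w := by
    obtain ⟨v, rfl⟩ := mk_surjective w
    exact congrArg (mk M S) (one_smul InfSymm v)
  mul_smul σ τ w := by
    obtain ⟨v, rfl⟩ := mk_surjective w
    exact congrArg (mk M S) (mul_smul (σ : InfSymm) (τ : InfSymm) v)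
  smul_zero σ := _root_.map_zero (act σ)
  smul_add σ := _root_.map_add (act σ)

theorem smul_mk (σ : MulAction.stabilizer InfSymm S) (x : M) :
    σ • mk M S x = mk M S ((σ : InfSymm) • x) := rfl

theorem semilinear (σ : MulAction.stabilizer InfSymm S) (a : RatField k) (w : OffQuotient M S) :
    σ • (a • w) = ((σ : InfSymm) • a) • (σ • w) := by
  obtain ⟨v, rfl⟩ := mk_surjective w
  exact congrArg (mk M S) (M.semilinear σ a v)

end OffQuotient

/-- The quotient by `offSpan M S`, for `S` of top degree, has a finite basis of invariants of the
stabilizer of `S`; its dual basis consists of equivariant functionals. -/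
theorem Bounded.exists_functionals {V : Finset ℕ} {d : ℕ}
    (h : Bounded V (d + 1) (⊤ : Submodule (RatField k) M)) :
    ∃ (S : Finset ℕ) (b : ℕ) (φ : Fin b → M →ₗ[RatField k] RatField k) (m : Fin b → M),
      S.card = d ∧ (∀ l, ∀ σ : InfSymm, σ • S = S → ∀ x, φ l (σ • x) = σ • φ l x) ∧
      (∀ x ∈ offSpan M S, ∀ l, φ l x = 0) ∧ (∀ x, (∀ l, φ l x = 0) → x ∈ offSpan M S) ∧
      ∀ l l', φ l (m l') = if l = l' then 1 else 0 := by
  classical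
  obtain ⟨S, hS, hSV⟩ := exists_disjoint_card V d
  obtain ⟨X, hX, hinv, htop⟩ := h.exists_invariant_generators hS hSV
  let π := OffQuotient.mk M S
  have hsuppX : ∀ x ∈ X, Supp (V ∪ S) x := fun x hx τ hτ => hinv x hx τ
    (mem_fixator_union.1 hτ).1 (smul_finset_eq_self (mem_fixator_union.1 hτ).2)
  -- A translate of a generator with `σ • S ≠ S` is supported by `V ∪ σ • S`, which does not contain
  -- `S`, so it dies in the quotient; the other translates are the generators themselves.
  have hspan : Submodule.span (RatField k) (π '' X) = ⊤ := by
    refine top_le_iff.1 ?_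
    rw [← LinearMap.range_eq_top.2 (OffQuotient.mk_surjective (M := M) (S := S)),
      LinearMap.range_eq_map, htop, Submodule.map_span, Submodule.span_le]
    rintro _ ⟨_, ⟨σ, hσ, x, hx, rfl⟩, rfl⟩
    by_cases hσS : σ • S = S
    · rw [hinv x hx σ hσ hσS]
      exact Submodule.subset_span ⟨x, hx, rfl⟩
    · have hmem : σ • x ∈ offSpan M S := by
        refine mem_offSpan (fun hsub => hσS ?_) (supp_smul_union hσ (hsuppX x hx))
        refine (Finset.eq_of_subset_of_card_le (fun i hi => ?_)
          (Finset.card_smul_finset σ S).le).symm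
        exact (Finset.mem_union.1 (hsub hi)).resolve_left (Finset.disjoint_left.1 hSV hi)
      rw [SetLike.mem_coe, OffQuotient.mk_eq_zero.2 hmem]
      exact Submodule.zero_mem _
  have hV : Submodule.span (RatField k)
      {w : OffQuotient M S | StabSupp (S := S) (V ∪ S) w} = ⊤ := by
    refine top_le_iff.1 (hspan ▸ Submodule.span_mono ?_)
    rintro _ ⟨x, hx, rfl⟩ τ hτ
    rw [OffQuotient.smul_mk, hsuppX x hx _ hτ]
  obtain ⟨ι, B₀, hB₀⟩ : ∃ (ι : Type u) (B : Module.Basis ι (RatField k) (OffQuotient M S)),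
      ∀ l, ∀ h : MulAction.stabilizer InfSymm S, h • B l = B l := by
    have hinvW := span_stabilizer_invariants OffQuotient.semilinear hV
    exact ⟨_, Module.Basis.ofSpan hinvW.ge, fun l =>
      Module.Basis.ofSpan_subset hinvW.ge ⟨l, rfl⟩⟩
  have hfin : Module.Finite (RatField k) (OffQuotient M S) :=
    Module.finite_def.2 (Submodule.fg_def.2 ⟨_, hX.image π, hspan⟩)
  have : Finite ι := Module.Finite.finite_basis B₀
  let B := B₀.reindex (Finite.equivFin ι)
  have hB : ∀ l, ∀ h : MulAction.stabilizer InfSymm S, h • B l = B l := fun l h => by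
    rw [B₀.reindex_apply, hB₀]
  choose m hm using fun l => OffQuotient.mk_surjective (B l)
  refine ⟨S, Nat.card ι, fun l => B.coord l ∘ₗ OffQuotient.mk M S, m, hS, ?_, ?_, ?_, ?_⟩
  · intro l σ hσ x
    let h : MulAction.stabilizer InfSymm S := ⟨σ, MulAction.mem_stabilizer_iff.2 hσ⟩
    change B.coord l (h • OffQuotient.mk M S x) = σ • B.coord l (OffQuotient.mk M S x)
    generalize OffQuotient.mk M S x = w
    have h1 : h • w = ∑ i, (σ • B.repr w i) • B i := by
      conv_lhs => rw [← B.sum_repr w]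
      rw [Finset.smul_sum]
      exact Finset.sum_congr rfl fun i _ => by rw [OffQuotient.semilinear, hB]
    rw [h1, Module.Basis.coord_apply, Module.Basis.coord_apply, B.repr_sum_self]
  · intro x hx l
    rw [LinearMap.comp_apply, OffQuotient.mk_eq_zero.2 hx, _root_.map_zero]
  · intro x hx
    refine OffQuotient.mk_eq_zero.1 (B.repr.injective ?_)
    ext l
    rw [_root_.map_zero]
    exact hx l
  · intro l l'
    rw [LinearMap.comp_apply, hm, Module.Basis.coord_apply, B.repr_self, Finsupp.single_apply]
    simp only [eq_comm]

/-- An equivariant functional for the stabilizer of `S` that vanishes on the vectors with a support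
not containing `S` is the `S`-coefficient of a morphism to `𝐈ʳ`. -/
theorem exists_hom_of_functional {r : ℕ} (S : Subsets r) (φ : M →ₗ[RatField k] RatField k)
    (hφ : ∀ σ : InfSymm, σ • S.1 = S.1 → ∀ x, φ (σ • x) = σ • φ x)
    (hS : ∀ x ∈ offSpan M S.1, φ x = 0) :
    ∃ q : M ⟶ std k r, ∀ x, StdSpace.coeff S (q.hom x) = φ x := by
  classical
  have htrans : ∀ T : Subsets r, ∃ σ : InfSymm, σ • S.1 = T.1 := fun T => by
    obtain ⟨σ, -, h⟩ := exists_smul_finset_eq (V := ∅) (Finset.disjoint_empty_right S.1)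
      (Finset.disjoint_empty_right T.1) (S.2.trans T.2.symm)
    exact ⟨σ, h⟩
  choose s hs using htrans
  -- Frobenius reciprocity: the coefficient at `T` is the functional transported from `S` to `T`,
  -- independent of the transporting permutation by `hφ`.
  let val : Subsets r → M → RatField k := fun T x => s T • φ ((s T)⁻¹ • x)
  have hval : ∀ (T : Subsets r) (σ : InfSymm), σ • S.1 = T.1 → ∀ x,
      val T x = σ • φ (σ⁻¹ • x) := by
    intro T σ hσ x
    have h1 : (s T)⁻¹ • x = ((s T)⁻¹ * σ) • σ⁻¹ • x := by rw [← mul_smul, mul_inv_cancel_right]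
    change s T • φ ((s T)⁻¹ • x) = _
    rw [h1, hφ, ← mul_smul, mul_inv_cancel_left]
    rw [mul_smul, hσ, inv_smul_eq_iff, hs]
  -- The coefficient vanishes unless `T` lies in a given finite support of `x`.
  have hfin : ∀ x, {T | val T x ≠ 0}.Finite := by
    intro x
    obtain ⟨U, hU⟩ := exists_supp x
    refine Set.Finite.of_finite_image (f := Subtype.val)
      (U.powerset.finite_toSet.subset ?_) Subtype.val_injective.injOn
    rintro _ ⟨T, hT, rfl⟩
    rw [Finset.mem_coe, Finset.mem_powerset]
    by_contra hTU
    refine hT ?_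
    have h1 : (s T)⁻¹ • x ∈ offSpan M S.1 := by
      have := smul_mem_offSpan (s T)⁻¹ (mem_offSpan hTU hU)
      rwa [← hs T, inv_smul_smul] at this
    change s T • φ ((s T)⁻¹ • x) = 0
    rw [hS _ h1, smul_zero]
  let q : M → std k r := fun x => (Finsupp.ofSupportFinite (fun T => val T x) (hfin x) :
    Subsets r →₀ RatField k)
  have hq : ∀ x T, StdSpace.coeff T (q x) = val T x := fun _ _ => rfl
  refine ⟨⟨⟨⟨q, fun x y => ?_⟩, fun a x => ?_⟩, fun σ x => ?_⟩, fun x => ?_⟩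
  · refine StdSpace.ext_coeff fun T => ?_
    refine Eq.trans ?_ (_root_.map_add (StdSpace.coeff T) (q x) (q y)).symm
    change s T • φ ((s T)⁻¹ • (x + y)) = s T • φ ((s T)⁻¹ • x) + s T • φ ((s T)⁻¹ • y)
    rw [smul_add, _root_.map_add, smul_add]
  · refine StdSpace.ext_coeff fun T => ?_
    refine Eq.trans ?_ (LinearMap.map_smul (StdSpace.coeff T) a (q x)).symm
    change val T (a • x) = a * val T x
    change s T • φ ((s T)⁻¹ • (a • x)) = a * s T • φ ((s T)⁻¹ • x)
    rw [M.semilinear, LinearMap.map_smul, smul_eq_mul, smul_mul', smul_inv_smul]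
  · refine StdSpace.ext_coeff fun T => ?_
    obtain ⟨T, rfl⟩ : ∃ T', T = Subsets.perm σ T' := ⟨_, (Subsets.perm_inv_perm σ T).symm⟩
    refine Eq.trans ?_ (StdSpace.coeff_perm_smul σ T (q x)).symm
    change val (Subsets.perm σ T) (σ • x) = σ • val T x
    rw [hval _ (σ * s T) (by rw [mul_smul, hs, Subsets.coe_perm]), mul_inv_rev, mul_smul,
      mul_smul, inv_smul_smul]
  · change val S x = φ x
    rw [hval S 1 (one_smul _ _), inv_one, one_smul, one_smul]

end SmoothRep

/-! ### Morphisms to standard objects and finite direct sums -/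

namespace SmoothRep

open InfSymm

variable {k : Type u} [Field k] {M N : SmoothRep k}

/-- The morphisms to `𝐈ᵈ` from an object of degree at most `d` detect the top degree part. -/
theorem Bounded.exists_homs {V : Finset ℕ} {d : ℕ}
    (h : Bounded V (d + 1) (⊤ : Submodule (RatField k) M)) :
    ∃ (S : Subsets d) (b : ℕ) (q : Fin b → (M ⟶ std k d)) (m : Fin b → M),
      (∀ l l', StdSpace.coeff S ((q l).hom (m l')) = if l = l' then 1 else 0) ∧
      ∀ x, (∀ l, (q l).hom x = 0) → ∀ T : Finset ℕ, T.card = d → x ∈ offSpan M T := by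
  obtain ⟨S, b, φ, m, hS, hφ, h0, hker, hdual⟩ := h.exists_functionals
  choose q hq using fun l => exists_hom_of_functional (r := d) ⟨S, hS⟩ (φ l) (hφ l)
    fun x hx => h0 x hx l
  refine ⟨⟨S, hS⟩, b, q, m, fun l l' => (hq l _).trans (hdual l l'), fun x hx T hT => ?_⟩
  obtain ⟨σ, -, rfl⟩ := exists_smul_finset_eq (V := ∅) (Finset.disjoint_empty_right S)
    (Finset.disjoint_empty_right T) (hS.trans hT.symm)
  have h1 : σ⁻¹ • x ∈ offSpan M S := hker _ fun l => by
    rw [← hq, SmoothRep.map_smul, hx, smul_zero]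
    exact _root_.map_zero (StdSpace.coeff _)
  have := smul_mem_offSpan σ h1
  rwa [smul_inv_smul] at this

/-- A subobject without top degree part has smaller degree. -/
theorem Bounded.of_le_offSpan {V : Finset ℕ} {d : ℕ}
    (h : Bounded V (d + 1) (⊤ : Submodule (RatField k) M)) {R : Submodule (RatField k) M}
    (hR : Stable ⊤ R) (hle : ∀ T : Finset ℕ, T.card = d → R ≤ offSpan M T) :
    ∃ V', Bounded V' d R := by
  -- With `A = ⊥` the part `P` vanishes and `E` contains all of `offSpan M S`, hence `R`. The
  -- component of an element of `R` in `C` must then be zero, which places `R` in the lower degree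
  -- part `N₀`.
  obtain ⟨S, V₀, N₀, P, C, E, hS, hV, hN₀, -, -, hP, hC, -, htop, -, hNE, hCE, hE⟩ :=
    h.exists_decomposition (A := ⊥) fun σ _ x hx => by
      rw [Submodule.mem_bot] at hx ⊢
      rw [hx, smul_zero]
  have hRE : R ≤ E := (hle S hS).trans (Submodule.span_le.2 (by
    rintro x ⟨U, hU, hx⟩
    exact hE x trivial U hU hx))
  have hRN : R ≤ N₀ := fun x hx => by
    have hx' : x ∈ N₀ ⊔ C := by
      have := htop (Submodule.mem_top (x := x))
      rwa [le_bot_iff.1 hP, bot_sup_eq] at this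
    obtain ⟨n, hn, c, hc, rfl⟩ := Submodule.mem_sup.1 hx'
    have hc0 : c = 0 := hCE c hc fun τ hτ => by
      have h1 : τ • c = τ • (n + c) - τ • n := by rw [smul_add, add_sub_cancel_left]
      rw [h1]
      exact sub_mem (hRE (hR τ trivial _ hx)) (hNE (hN₀.stable τ hτ n hn))
    rwa [hc0, add_zero]
  obtain ⟨V', -, hV'⟩ := hN₀.of_le (hR.mono le_top) hRN
  exact ⟨V', hV'⟩

theorem Bounded.map {V : Finset ℕ} {d : ℕ} {R : Submodule (RatField k) M} (h : Bounded V d R)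
    (f : M ⟶ N) : Bounded V d (R.map f.hom) := by
  obtain ⟨X, hX, hU, rfl⟩ := h
  refine ⟨f.hom '' X, hX.image _, ?_, ?_⟩
  · rintro _ ⟨x, hx, rfl⟩
    obtain ⟨U, hU, hsupp⟩ := hU x hx
    exact ⟨U, hU, fun σ hσ => by rw [← SmoothRep.map_smul, hsupp σ hσ]⟩
  · rw [Submodule.map_span]
    congr 1
    ext y
    constructor
    · rintro ⟨_, ⟨σ, hσ, x, hx, rfl⟩, rfl⟩
      exact ⟨σ, hσ, _, ⟨x, hx, rfl⟩, SmoothRep.map_smul f σ x⟩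
    · rintro ⟨σ, hσ, _, ⟨x, hx, rfl⟩, rfl⟩
      exact ⟨_, ⟨σ, hσ, x, hx, rfl⟩, SmoothRep.map_smul f σ x⟩

theorem Bounded.top_of_surjective {V : Finset ℕ} {d : ℕ}
    (h : Bounded V d (⊤ : Submodule (RatField k) M)) (f : M ⟶ N)
    (hf : Function.Surjective f.hom) : Bounded V d (⊤ : Submodule (RatField k) N) := by
  have := h.map f
  rwa [Submodule.map_top, LinearMap.range_eq_top.2 hf] at this

theorem Bounded.top_sub {V : Finset ℕ} {d : ℕ} {p : Submodule (RatField k) M}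
    (h : Bounded V d p) (hp : ∀ (σ : InfSymm) (v : M), v ∈ p → σ • v ∈ p) :
    Bounded V d (⊤ : Submodule (RatField k) (M.sub p hp)) := by
  obtain ⟨X, hX, hU, hpX⟩ := h
  have hXp : X ⊆ p := fun x hx => hpX ▸ span_le_span_translates (Submodule.subset_span hx)
  have himg : p.subtype '' (p.subtype ⁻¹' X) = X := by
    rw [Set.image_preimage_eq_iff]
    exact fun x hx => ⟨⟨x, hXp hx⟩, rfl⟩
  refine ⟨p.subtype ⁻¹' X, hX.preimage Subtype.val_injective.injOn, fun x hx => ?_, ?_⟩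
  · obtain ⟨U, hU, hsupp⟩ := hU x.1 hx
    exact ⟨U, hU, fun σ hσ => Subtype.ext (hsupp σ hσ)⟩
  · refine (top_le_iff.1 fun y _ => ?_).symm
    have hy : y.1 ∈ Submodule.span (RatField k) (translates (fixator V : Set InfSymm) X) :=
      hpX ▸ y.2
    have hle : Submodule.span (RatField k) (translates (fixator V : Set InfSymm) X) ≤
        Submodule.map (M.subι p hp).hom (Submodule.span (RatField k)
          (translates (M := M.sub p hp) (fixator V : Set InfSymm) (p.subtype ⁻¹' X))) :=
      Submodule.span_le.2 (by
        rintro _ ⟨σ, hσ, x, hx, rfl⟩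
        exact ⟨_, smul_mem_translates (M := M.sub p hp) hσ
          (show (⟨x, hXp hx⟩ : p) ∈ p.subtype ⁻¹' X from hx), rfl⟩)
    obtain ⟨z, hz, hzy⟩ := hle hy
    have : z = y := Subtype.ext hzy
    exact this ▸ hz

theorem mono_of_injective (f : M ⟶ N) (hf : Function.Injective f.hom) : Mono f where
  right_cancellation _ _ w := hom_ext fun v => hf (congrArg (fun q => Hom.hom q v) w)

section DirectSum

variable {ι : Type u} {X : ι → SmoothRep k}

open Classical in
/-- The inclusion of a summand. -/
noncomputable def inclusion (X : ι → SmoothRep k) (i : ι) : X i ⟶ directSum X :=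
  Hom.mk (N := directSum X) (DFinsupp.lsingle (M := fun i => X i) i) fun σ v =>
    (DFinsupp.single_smul (β := fun i => X i) (i := i) σ v)

/-- The projection to a summand. -/
noncomputable def projection (X : ι → SmoothRep k) (i : ι) : directSum X ⟶ X i :=
  ⟨DFinsupp.lapply i, fun _ _ => rfl⟩

theorem directSum_ext {v w : directSum X}
    (h : ∀ i, (projection X i).hom v = (projection X i).hom w) : v = w := DFinsupp.ext h

theorem directSum_induction {p : directSum X → Prop} (v : directSum X) (h0 : p 0)
    (hadd : ∀ v w, p v → p w → p (v + w)) (hs : ∀ i x, p ((inclusion X i).hom x)) : p v := by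
  classical
  exact DFinsupp.induction v h0 fun i b f _ _ hf => hadd _ _ (hs i b) hf

/-- A vector whose components lie in the submodules `offSpan` does so itself. -/
theorem mem_offSpan_of_projection (v : directSum X) {S : Finset ℕ}
    (h : ∀ i, (projection X i).hom v ∈ offSpan (X i) S) : v ∈ offSpan (directSum X) S := by
  classical
  have hv : v = ∑ i ∈ DFinsupp.support (β := fun i => X i) v,
      (inclusion X i).hom ((projection X i).hom v) :=
    (DFinsupp.sum_single (β := fun i => X i) (f := v)).symm
  rw [hv]
  exact sum_mem fun i _ => map_mem_offSpan _ (h i)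

/-- The morphism to a finite direct sum with given components. -/
noncomputable def toDirectSum [Finite ι] (φ : ∀ i, M ⟶ X i) : M ⟶ directSum X :=
  haveI := Fintype.ofFinite ι
  Hom.mk (N := directSum X)
    ((DFinsupp.linearEquivFunOnFintype (R := RatField k) (M := fun i => X i)).symm.toLinearMap ∘ₗ
      LinearMap.pi fun i => (φ i).hom)
    fun σ v => DFinsupp.ext fun i => SmoothRep.map_smul (φ i) σ v

theorem projection_toDirectSum [Finite ι] (φ : ∀ i, M ⟶ X i) (i : ι) (v : M) :
    (projection X i).hom ((toDirectSum φ).hom v) = (φ i).hom v := rfl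

instance injective_directSum [Finite ι] [∀ i, Injective (X i)] : Injective (directSum X) where
  factors {Y Z} g f _ := ⟨toDirectSum fun i => Injective.factorThru (g ≫ projection X i) f, by
    ext v
    refine directSum_ext fun i => ?_
    have := congrArg (fun q => Hom.hom q v) (Injective.comp_factorThru (g ≫ projection X i) f)
    exact (projection_toDirectSum _ i _).trans this⟩

theorem inclusion_smul_smul (i : ι) (a : RatField k) (σ : InfSymm) (x : X i) :
    (inclusion X i).hom (a • σ • x) = a • σ • (inclusion X i).hom x := by
  rw [LinearMap.map_smul, SmoothRep.map_smul]

end DirectSum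

theorem mem_offSpan_std {r : ℕ} {S : Finset ℕ} (v : std k r)
    (h : ∀ T : Subsets r, S ⊆ T.1 → StdSpace.coeff T v = 0) : v ∈ offSpan (std k r) S := by
  classical
  have hv : (Finsupp.sum (M := RatField k) v fun T a => (StdSpace.single T a : std k r)) = v :=
    Finsupp.sum_single (M := RatField k) v
  rw [← hv]
  refine Submodule.sum_mem _ fun T hT => ?_
  have hT' : ¬S ⊆ T.1 := fun hS => (Finsupp.mem_support_iff (M := RatField k)).1 hT (h T hS)
  have h1 : StdSpace.single T (StdSpace.coeff T v) =
      StdSpace.coeff T v • (StdSpace.single T 1 : std k r) := by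
    refine Eq.trans ?_ (StdSpace.smul_single _ _ _).symm
    rw [mul_one]
  change StdSpace.single T (StdSpace.coeff T v) ∈ _
  rw [h1]
  refine Submodule.smul_mem _ _ (mem_offSpan hT' ?_)
  have := StdSpace.supp_single (U := ∅) (a := (1 : RatField k)) (fun σ _ => smul_one σ) T
  rwa [Finset.empty_union] at this

/-- 𝔖 is transitive on the sets of a given size, so one basis vector from each summand generates,
and its index set is a support. -/
theorem bounded_directSum_std {ι : Type u} [Finite ι] {r : ι → ℕ} {d : ℕ} (hr : ∀ i, r i < d) :
    Bounded ∅ d (⊤ : Submodule (RatField k) (directSum fun i => std k (r i))) := by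
  choose S hS using fun i => exists_disjoint_card ∅ (r i)
  let X := fun i => std k (r i)
  let S' : ∀ i, Subsets (r i) := fun i => ⟨S i, (hS i).1⟩
  let e : ι → directSum X := fun i => (inclusion X i).hom (StdSpace.single (S' i) 1 : std k (r i))
  refine ⟨Set.range e, Set.finite_range e, ?_, (top_le_iff.1 fun v _ => ?_).symm⟩
  · rintro _ ⟨i, rfl⟩
    refine ⟨S i, (hS i).1.trans_lt (hr i), fun σ hσ => ?_⟩
    exact (SmoothRep.map_smul (inclusion X i) σ _).symm.trans (congrArg (inclusion X i).hom
      (StdSpace.supp_single (U := ∅) (a := (1 : RatField k)) (fun σ _ => smul_one σ) (S' i) σ hσ))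
  · induction v using directSum_induction with
    | h0 => exact Submodule.zero_mem _
    | hadd v w hv hw => exact Submodule.add_mem _ (hv trivial) (hw trivial)
    | hs i x =>
      induction x using StdSpace.induction with
      | zero =>
        have : (inclusion X i).hom (0 : std k (r i)) = 0 := _root_.map_zero _
        exact this ▸ Submodule.zero_mem _
      | add x y hx hy =>
        have : (inclusion X i).hom ((x : std k (r i)) + (y : std k (r i))) = _ :=
          _root_.map_add _ _ _
        exact this ▸ Submodule.add_mem _ (hx trivial) (hy trivial)
      | hs T a =>
        obtain ⟨σ, hσ, hσT⟩ := exists_smul_finset_eq (hS i).2 (Finset.disjoint_empty_right T.1)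
          ((hS i).1.trans T.2.symm)
        have h1 : (StdSpace.single T a : std k (r i)) =
            a • σ • (StdSpace.single (S' i) 1 : std k (r i)) := by
          refine Eq.symm ((congrArg (a • ·) (StdSpace.perm_smul_single σ (S' i) 1)).trans ?_)
          refine (StdSpace.smul_single _ _ _).trans ?_
          rw [smul_one, mul_one, show Subsets.perm σ (S' i) = T from
            Subtype.ext ((Subsets.coe_perm σ (S' i)).trans hσT)]
        have h2 : (inclusion X i).hom (StdSpace.single T a : std k (r i)) = a • σ • e i :=
          (congrArg (inclusion X i).hom h1).trans (inclusion_smul_smul (X := X) i a σ _)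
        exact h2 ▸ Submodule.smul_mem _ _ (smul_mem_translates hσ ⟨i, rfl⟩)

end SmoothRep

/-! ### Embedding with smaller cokernel, and the resolution -/

namespace SmoothRep

open InfSymm

variable {k : Type u} [Field k] {M N : SmoothRep k}

/-- A degree `d` part of a cokernel vanishes if the top degree part of the target is hit. -/
theorem top_le_offSpan_of_surjective {J Z : SmoothRep k} (π : J ⟶ Z)
    (hπ : Function.Surjective π.hom) {S : Finset ℕ}
    (h : ∀ w : J, ∃ w' ∈ offSpan J S, π.hom w' = π.hom w) {T : Finset ℕ} (hT : T.card = S.card) :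
    (⊤ : Submodule (RatField k) Z) ≤ offSpan Z T := by
  obtain ⟨σ, -, rfl⟩ := exists_smul_finset_eq (V := ∅) (Finset.disjoint_empty_right S)
    (Finset.disjoint_empty_right T) hT.symm
  intro z _
  obtain ⟨w, hw⟩ := hπ (σ⁻¹ • z)
  obtain ⟨w', hw', hww⟩ := h w
  have h1 := smul_mem_offSpan σ (map_mem_offSpan π hw')
  rwa [hww, hw, smul_inv_smul] at h1

/-- An object of degree at most `d` embeds in a finite standard object with a cokernel of
smaller degree. -/
theorem Bounded.exists_embedding {d : ℕ} : ∀ {V : Finset ℕ} {M : SmoothRep k},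
    Bounded V d (⊤ : Submodule (RatField k) M) →
    ∃ (ι : Type u) (_ : Finite ι) (r : ι → ℕ) (_ : ∀ i, r i < d)
      (f : M ⟶ directSum fun i => std k (r i)), Function.Injective f.hom ∧
      ∃ V', Bounded V' (d - 1)
        (⊤ : Submodule (RatField k) (quot _ (LinearMap.range f.hom) (range_stable f))) := by
  induction d with
  | zero =>
    intro V M h
    have hM := bounded_zero h
    refine ⟨PEmpty, inferInstance, PEmpty.elim, fun i => i.elim, 0, fun x y _ => ?_, ∅, ?_⟩
    · have hx : ∀ x : M, x = 0 := fun x => by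
        have : x ∈ (⊤ : Submodule (RatField k) M) := trivial
        rwa [hM, Submodule.mem_bot] at this
      rw [hx x, hx y]
    -- Here `d - 1` is truncated to `0`, and the cokernel is a quotient of an empty sum.
    · exact (bounded_directSum_std fun i => i.elim).top_of_surjective (quotπ _ _ _)
        (Submodule.mkQ_surjective _)
  | succ d ih =>
    intro V M h
    obtain ⟨S, b, q, m, hdual, hker⟩ := h.exists_homs
    -- The part not seen by the maps to 𝐈ᵈ has smaller degree. It embeds by induction, and the
    -- embedding extends to `M` because its target is injective.
    let p : Submodule (RatField k) M := ⨅ l, LinearMap.ker (q l).hom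
    have hmem : ∀ {x : M}, x ∈ p ↔ ∀ l, (q l).hom x = 0 := fun {x} => by
      simp only [p, Submodule.mem_iInf, LinearMap.mem_ker]
    have hp : ∀ (σ : InfSymm) (v : M), v ∈ p → σ • v ∈ p := fun σ v hv =>
      hmem.2 fun l => LinearMap.mem_ker.1 (ker_stable (q l) σ v (hmem.1 hv l))
    obtain ⟨V', hV'⟩ := h.of_le_offSpan (R := p) (fun σ _ v hv => hp σ v hv)
      fun T hT x hx => hker x (hmem.1 hx) T hT
    obtain ⟨ι', _, r', hr', f', hf', -⟩ := ih (hV'.top_sub hp)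
    have : Mono (M.subι p hp) := mono_of_injective _ Subtype.val_injective
    let X' : ι' → SmoothRep k := fun i => std k (r' i)
    let g : ∀ i, M ⟶ X' i := fun i => Injective.factorThru (f' ≫ projection X' i) (M.subι p hp)
    have hg : ∀ i (x : M.sub p hp), (g i).hom ((M.subι p hp).hom x) =
        (projection X' i).hom (f'.hom x) := fun i x =>
      congrArg (fun t => Hom.hom t x)
        (Injective.comp_factorThru (f' ≫ projection X' i) (M.subι p hp))
    let r : ULift.{u} (Fin b) ⊕ ι' → ℕ := Sum.elim (fun _ => d) r'
    let φ : ∀ i, M ⟶ std k (r i) := fun i => Sum.rec (motive := fun i => M ⟶ std k (r i))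
      (fun l => q l.down) g i
    have hr : ∀ i, r i < d + 1 := by
      rintro (l | i)
      · exact Nat.lt_succ_self d
      · exact Nat.lt_succ_of_lt (hr' i)
    let f : M ⟶ directSum fun i => std k (r i) := toDirectSum φ
    have hf : ∀ i x, (projection _ i).hom (f.hom x) = (φ i).hom x :=
      fun i x => projection_toDirectSum φ i x
    have hinj : Function.Injective f.hom := by
      rw [← LinearMap.ker_eq_bot, LinearMap.ker_eq_bot']
      intro x hx
      have hφ : ∀ i, (φ i).hom x = 0 := fun i => by
        rw [← hf, hx]
        exact _root_.map_zero _
      have hxp : x ∈ p := hmem.2 fun l => hφ (Sum.inl ⟨l⟩)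
      have h0 : f'.hom (⟨x, hxp⟩ : p) = 0 := directSum_ext fun i => by
        refine (hg i ⟨x, hxp⟩).symm.trans ((hφ (Sum.inr i)).trans ?_)
        exact (_root_.map_zero (projection X' i).hom).symm
      exact congrArg Subtype.val (hf' (h0.trans (_root_.map_zero f'.hom).symm))
    refine ⟨_, inferInstance, r, hr, f, hinj, ?_⟩
    let π := quotπ _ (LinearMap.range f.hom) (range_stable f)
    have hπ : Function.Surjective π.hom := Submodule.mkQ_surjective _
    refine ((bounded_directSum_std hr).top_of_surjective π hπ).of_le_offSpan
      (fun _ _ _ _ => trivial) fun T hT => top_le_offSpan_of_surjective π hπ (S := S.1) ?_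
        (hT.trans S.2.symm)
    intro w
    -- Subtracting the image of `∑ l, c l • m l` clears every coefficient at `S` in the copies of
    -- 𝐈ᵈ, by duality of the `m l` with the functionals; this does not change the class in the
    -- cokernel.
    let c : Fin b → RatField k := fun l =>
      StdSpace.coeff S ((projection _ (Sum.inl ⟨l⟩)).hom w : std k d)
    refine ⟨w - f.hom (∑ l, c l • m l), mem_offSpan_of_projection _ fun i => ?_, ?_⟩
    · refine mem_offSpan_std _ fun T hT => ?_
      rcases i with ⟨⟨l⟩⟩ | i
      · obtain rfl : S = T := Subtype.ext (Finset.eq_of_subset_of_card_le hT (by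
          rw [S.2]; exact T.2.le))
        have h1 : StdSpace.coeff S ((q l).hom (∑ l', c l' • m l')) = c l := by
          rw [map_sum]
          refine (map_sum (StdSpace.coeff S) _ _).trans ?_
          rw [Finset.sum_eq_single l]
          · rw [LinearMap.map_smul]
            refine (LinearMap.map_smul (StdSpace.coeff S) _ _).trans ?_
            rw [hdual, if_pos rfl, smul_eq_mul, mul_one]
          · intro l' _ hl
            rw [LinearMap.map_smul]
            refine (LinearMap.map_smul (StdSpace.coeff S) _ _).trans ?_
            rw [hdual, if_neg hl.symm, smul_zero]
          · exact fun hl => absurd (Finset.mem_univ l) hl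
        have h2 := map_sub (projection (fun i => std k (r i)) (Sum.inl ⟨l⟩)).hom w
          (f.hom (∑ l, c l • m l))
        rw [hf] at h2
        refine (congrArg (StdSpace.coeff S) h2).trans ?_
        refine (map_sub (StdSpace.coeff S) _ _).trans ?_
        exact sub_eq_zero.2 h1.symm
      -- The summands coming from the induction have `r' i < d`, so none of their index sets
      -- contains `S`.
      · exfalso
        have h1 := Finset.card_le_card hT
        rw [S.2, T.2] at h1
        exact absurd (hr' i) (not_lt.2 h1)
    · rw [map_sub, sub_eq_self]
      exact (Submodule.Quotient.mk_eq_zero _).2 ⟨_, rfl⟩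

theorem Bounded.isFinitelyGenerated {d : ℕ} (h : Bounded ∅ d (⊤ : Submodule (RatField k) M)) :
    M.IsFinitelyGenerated := by
  obtain ⟨X, hX, -, hspan⟩ := h
  refine ⟨hX.toFinset, top_le_iff.1 (hspan.le.trans (Submodule.span_mono ?_))⟩
  rintro _ ⟨σ, -, x, hx, rfl⟩
  exact ⟨σ, x, hX.mem_toFinset.2 hx, rfl⟩

theorem IsFinitelyGenerated.bounded (h : M.IsFinitelyGenerated) :
    ∃ d, Bounded ∅ d (⊤ : Submodule (RatField k) M) := by
  obtain ⟨s, hs⟩ := h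
  obtain ⟨V, hV⟩ := exists_supp_of_finite s.finite_toSet
  refine ⟨V.card + 1, s, s.finite_toSet, fun x hx => ⟨V, Nat.lt_succ_self _, ?_⟩, ?_⟩
  · rw [Finset.empty_union]
    exact hV x hx
  · refine hs.symm.trans (le_antisymm (Submodule.span_mono ?_) (hs ▸ le_top))
    rintro _ ⟨σ, x, hx, rfl⟩
    exact ⟨σ, mem_fixator.2 fun i hi => absurd hi (Finset.notMem_empty i), x, hx, rfl⟩

theorem shortExact_quot (f : M ⟶ N) (hf : Function.Injective f.hom) :
    (ShortComplex.mk f (quotπ N (LinearMap.range f.hom) (range_stable f)) (by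
      ext v; exact (Submodule.Quotient.mk_eq_zero _).2 ⟨v, rfl⟩)).ShortExact where
  exact := ShortComplex.exact_of_f_is_kernel _ (isLimitOfExact _ _ _ hf
    fun _ hv => (Submodule.Quotient.mk_eq_zero _).1 hv)
  mono_f := mono_of_injective f hf
  epi_g := ⟨fun _ _ w => hom_ext fun v => by
    obtain ⟨v, rfl⟩ := Submodule.mkQ_surjective _ v
    exact congrArg (fun t => Hom.hom t v) w⟩

/-- Finite injective dimension together with a finite resolution by finitely generated standard
objects. -/
def HasFiniteStandardResolution (M : SmoothRep k) : Prop :=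
  (∃ n : ℕ, HasInjectiveDimensionLE M n) ∧
    ∃ (n : ℕ) (I : ℕ → SmoothRep k) (ε : M ⟶ I 0) (d : ∀ i, I i ⟶ I (i + 1)),
      (∀ i, i ≤ n → (I i).IsStandard ∧ (I i).IsFinitelyGenerated) ∧
      (∀ i, n < i → IsZero (I i)) ∧
      Function.Injective ε.hom ∧
      Function.Exact ε.hom (d 0).hom ∧
      ∀ i, Function.Exact (d i).hom (d (i + 1)).hom

theorem hasFiniteStandardResolution_of_isZero (h : IsZero M) : HasFiniteStandardResolution M := by
  have hM : ∀ x : M, x = 0 := fun x =>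
    congrArg (fun t => Hom.hom t x) (h.eq_of_src (𝟙 M) 0)
  have := h.hasInjectiveDimensionLT_zero
  refine ⟨⟨0, hasInjectiveDimensionLT_of_ge M 0 _ (Nat.zero_le _)⟩,
    0, fun _ => zeroRep k, 0, fun _ => 0, fun i _ => ⟨?_, ∅, ?_⟩, fun _ _ => isZero_zeroRep,
    fun x y _ => (hM x).trans (hM y).symm, fun x => ⟨fun _ => ⟨0, rfl⟩, fun _ => rfl⟩,
    fun _ x => ⟨fun _ => ⟨x, rfl⟩, fun _ => rfl⟩⟩
  · refine ⟨PEmpty, PEmpty.elim, ⟨isZero_zeroRep.iso ?_⟩⟩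
    rw [IsZero.iff_id_eq_zero]
    exact hom_ext fun v => directSum_ext fun i => i.elim
  · exact top_le_iff.1 fun x _ => Submodule.zero_mem _

/-- The resolution of the cokernel is spliced onto the embedding. The middle term is injective, so
the injective dimension grows by at most one. -/
theorem HasFiniteStandardResolution.of_embedding {ι : Type u} [Finite ι] {r : ι → ℕ}
    (f : M ⟶ directSum fun i => std k (r i)) (hf : Function.Injective f.hom)
    (h : HasFiniteStandardResolution (quot _ (LinearMap.range f.hom) (range_stable f))) :
    HasFiniteStandardResolution M := by
  obtain ⟨⟨m, hm⟩, n, I, ε, δ, hstd, hzero, hinj, hexact₀, hexact⟩ := h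
  obtain ⟨D, hD⟩ : ∃ D, ∀ i, r i < D := by
    obtain ⟨D, hD⟩ := (Set.finite_range r).bddAbove
    exact ⟨D + 1, fun i => Nat.lt_succ_of_le (hD ⟨i, rfl⟩)⟩
  let J := directSum fun i => std k (r i)
  let π := quotπ J (LinearMap.range f.hom) (range_stable f)
  have hπ : Function.Surjective π.hom := Submodule.mkQ_surjective _
  -- The old resolution is shifted by one place, and the new differential out of `J` is the
  -- projection to the cokernel followed by `ε`.
  refine ⟨⟨m + 1, ?_⟩, n + 1, fun i => Nat.casesOn i J I, f,
    fun i => Nat.rec (motive := fun i => (Nat.casesOn i J I : SmoothRep k) ⟶ I i)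
      (π ≫ ε) (fun i _ => δ i) i, ?_, ?_, hf, ?_, ?_⟩
  · have : HasInjectiveDimensionLT J 1 := inferInstance
    exact (shortExact_quot f hf).hasInjectiveDimensionLT_X₁ (m + 1) hm
      (hasInjectiveDimensionLT_of_ge J 1 _ (Nat.le_add_left _ _))
  · rintro (_ | i) hi
    · exact ⟨⟨ι, r, ⟨Iso.refl _⟩⟩, (bounded_directSum_std hD).isFinitelyGenerated⟩
    · exact hstd i (Nat.le_of_succ_le_succ hi)
  · rintro (_ | i) hi
    · exact absurd hi (Nat.not_lt_zero _)
    · exact hzero i (Nat.lt_of_succ_lt_succ hi)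
  · intro x
    change ε.hom (π.hom x) = 0 ↔ _
    rw [map_eq_zero_iff ε.hom hinj]
    exact Submodule.Quotient.mk_eq_zero _
  · rintro (_ | i)
    · intro x
      change (δ 0).hom x = 0 ↔ x ∈ Set.range fun y => ε.hom (π.hom y)
      rw [hexact₀ x]
      exact (hπ.range_comp ε.hom ▸ Iff.rfl)
    · exact hexact i

/-- The set `V` has to vary in the induction, because the bound on the cokernel holds over another
finite set. -/
theorem Bounded.hasFiniteStandardResolution {d : ℕ} : ∀ {V : Finset ℕ} {M : SmoothRep k},
    Bounded V d (⊤ : Submodule (RatField k) M) → HasFiniteStandardResolution M := by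
  induction d with
  | zero =>
    intro V M h
    refine hasFiniteStandardResolution_of_isZero ((IsZero.iff_id_eq_zero _).2 (hom_ext fun x => ?_))
    have : x ∈ (⊤ : Submodule (RatField k) M) := trivial
    rwa [bounded_zero h, Submodule.mem_bot] at this
  | succ d ih =>
    intro V M h
    obtain ⟨ι, _, r, -, f, hf, V', hV'⟩ := h.exists_embedding
    exact .of_embedding f hf (ih hV')

end SmoothRep

end

theorem proposition3p9 {k : Type u} [Field k] (M : SmoothRep k)
    (hM : M.IsFinitelyGenerated) :
    (∃ n : ℕ, HasInjectiveDimensionLE M n) ∧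
    ∃ (n : ℕ) (I : ℕ → SmoothRep k) (ε : M ⟶ I 0) (d : ∀ i, I i ⟶ I (i + 1)),
      (∀ i, i ≤ n → (I i).IsStandard ∧ (I i).IsFinitelyGenerated) ∧
      (∀ i, n < i → IsZero (I i)) ∧
      Function.Injective ε.hom ∧
      Function.Exact ε.hom (d 0).hom ∧
      ∀ i, Function.Exact (d i).hom (d (i + 1)).hom := by
  obtain ⟨d, hd⟩ := hM.bounded
  exact hd.hasFiniteStandardResolution
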